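/- **Setting.** Let $\mathcal Q$ be a finite set of queries, $P$ a probability distribution on $\mathcal Q$, and for each $q\in\mathcal Q$ let $C_l(q)$ be a random cost with mean $c_l^\star(q)$. In each round $t=1,\dots,T$ a query $q_t\sim P$ arrives, independently of the past. If $q_t$ is in the current cache $\mathcal L_t\subset\mathcal Q$ (a hit), the cost is $0$ and nothing is observed. If $q_t\notin\mathcal L_t$ (a miss), an independent sample $c_t$ of $C_l(q_t)$ is observed. Put $\mathsf{cost}(q,\mathcal L)=\mathbb 1(q\notin\mathcal L)\,c_l^\star(q)$, let $\mathcal L^\star$ be any minimizer of $\sum_q P(q)\,\mathsf{cost}(q,\mathcal L)$ over $|\mathcal L|\le L$, and $$\mathsf{Regret}(T)=\sum_{t=1}^T\mathbb E[\mathsf{cost}(q_t,\mathcal L_t)-\mathsf{cost}(q_t,\mathcal L^\star)].$$ **Algorithm.** Let $\hat P_t(q)=\frac1t\sum_{i\le t}\mathbb 1(q_i=q)$, let $n_t(q)$ be the number of rounds $i\le t$ with $q_i=q$ that were misses, and let $\bar c_t(q)$ be the mean of the costs observed in them. Put $\hat c_t(q)=B_1$ if $n_t(q)=0$, and otherwise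 $$\hat c_t(q)=\max\Big(B_1,\ \bar c_t(q)-(B_2-B_1)\sqrt{\tfrac{\log(6T|\mathcal Q|/\delta)}{2n_t(q)}}\Big),\qquad \delta=1/T.$$ Start with $\mathcal L_1=\emptyset$. On a hit put $\mathcal L_{t+1}=\mathcal L_t$. On a miss: if $|\mathcal L_t|<L$ put $\mathcal L_{t+1}=\mathcal L_t\cup\{q_t\}$; otherwise, if $\hat P_t(q_t)\hat c_t(q_t)>\min_{q\in\mathcal L_t}\hat P_t(q)\hat c_t(q)$, replace a minimizer $q\in\mathcal L_t$ of $\hat P_t(q)\hat c_t(q)$ by $q_t$ (ties are broken by any rule that depends only on the tied set and the queries received so far); otherwise put $\mathcal L_{t+1}=\mathcal L_t$. **Upper bound.** There is a universal constant $C>0$ such that, whenever $B_2>B_1>0$, all costs $C_l(q)$ are supported on $[B_1,B_2]$, and $T|\mathcal Q|\ge2$, the algorithm satisfies $$\mathsf{Regret}(T)\le C\left(\frac{L^2(B_2-B_1)B_2|\mathcal Q|\log^2(T|\mathcal Q|)}{B_1}\sqrt T+LB_2\sqrt{T\log(T|\mathcal Q|)}\right),$$ and if moreover $B_1\le 2L|\mathcal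 Q|(B_2-B_1)\log(T|\mathcal Q|)$ (which holds, when $L\ge1$, as soon as $B_2\ge 2B_1$ and, for any fixed $B_1<B_2$, as soon as $T$ is large enough), then $$\mathsf{Regret}(T)\le \frac{C\,L^2(B_2-B_1)B_2|\mathcal Q|\log^2(T|\mathcal Q|)}{B_1}\sqrt T .$$ **Lower bound.** There is a universal constant $C'>0$ such that for all $0\le B_1<B_2$, all $T\ge1$, and every (possibly randomized) caching policy $\{\mathcal L_t\}_{t=1}^T$ on two queries with cache size $L=1$, where $\mathcal L_t$ depends only on the observations before round $t$ and on the policy's own randomness, there are a query distribution $P$ and cost laws carried by the two points $B_1,B_2$ for which $$\mathsf{Regret}(T)\ge C'(B_2-B_1)\sqrt T .$$ In particular, with $B_1=0$, $B_2=1$, the costs are Bernoulli and $\mathsf{Regret}(T)\ge C'\sqrt T$. -/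

import Mathlib

open MeasureTheory

/-- A history of the caching process, newest round first.  An entry `(q, some c)` records a round in
which the query `q` missed the cache and the cost `c` was observed; `(q, none)` records a round in
which `q` hit the cache, so that no cost was observed. -/
abbrev CacheHistory (Q : Type*) := List (Q × Option ℝ)

/-- A (deterministic) caching policy: the cache of a round, as a function of all observations made
in the rounds before it. -/
abbrev CachePolicy (Q : Type*) := CacheHistory Q → Finset Q

/-- A problem instance: the query distribution and, for each query, the law of its cost. -/
structure CacheInstance (Q : Type*) where
  /-- the population distribution of the queries -/
  P : PMF Q
  /-- the law of the cost of processing a query -/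
  costLaw : Q → Measure ℝ
  isProbability_costLaw : ∀ q, IsProbabilityMeasure (costLaw q)

namespace CacheInstance

variable {Q : Type*} [Fintype Q] [DecidableEq Q]

/-- The expected cost of processing the query `q`. -/
noncomputable def meanCost (I : CacheInstance Q) (q : Q) : ℝ := ∫ x, x ∂(I.costLaw q)

/-- The expected cost of the query `q` under the cache `S`. -/
noncomputable def cost (I : CacheInstance Q) (q : Q) (S : Finset Q) : ℝ :=
  if q ∈ S then 0 else I.meanCost q

/-- The expected cost of the cache `S`. -/
noncomputable def expectedCost (I : CacheInstance Q) (S : Finset Q) : ℝ :=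
  ∑ q, (I.P q).toReal * I.cost q S

/-- `S` is an optimal cache of size at most `L`. -/
def IsOptimalCache (I : CacheInstance Q) (L : ℕ) (S : Finset Q) : Prop :=
  S.card ≤ L ∧ ∀ S' : Finset Q, S'.card ≤ L → I.expectedCost S ≤ I.expectedCost S'

/-- Optimal caches exist. -/
theorem exists_isOptimalCache (I : CacheInstance Q) (L : ℕ) :
    ∃ S : Finset Q, I.IsOptimalCache L S := by
  obtain ⟨S, hS, hmin⟩ := Finset.exists_min_image
    ((Finset.univ : Finset (Finset Q)).filter fun S => S.card ≤ L) I.expectedCost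
    ⟨∅, by simp⟩
  exact ⟨S, (Finset.mem_filter.1 hS).2, fun S' h => hmin S' (by simpa using h)⟩

/-- The law of one round: the query `q` is drawn from `P`, the cost from the cost law of `q`.
(The cost of a query that hits the cache is never shown to the policy.) -/
noncomputable def roundLaw [MeasurableSpace Q] (I : CacheInstance Q) : Measure (Q × ℝ) :=
  ∑ q, I.P q • (I.costLaw q).map (Prod.mk q)

instance [MeasurableSpace Q] (I : CacheInstance Q) : IsProbabilityMeasure I.roundLaw := by
  constructor
  have h : ∀ q, ((I.costLaw q).map (Prod.mk q)) Set.univ = 1 := fun q => by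
    have := I.isProbability_costLaw q
    rw [Measure.map_apply measurable_prodMk_left MeasurableSet.univ]
    simp
  simp only [roundLaw, Measure.finsetSum_apply, Measure.smul_apply, h, smul_eq_mul, mul_one]
  rw [← tsum_fintype (L := .unconditional Q)]
  exact I.P.tsum_coe

/-- The law of the whole sequence of rounds, which are independent and identically distributed. -/
noncomputable def trajectoryLaw [MeasurableSpace Q] (I : CacheInstance Q) :
    Measure (ℕ → Q × ℝ) :=
  Measure.infinitePi fun _ : ℕ => I.roundLaw

end CacheInstance

/-- The history after `t` rounds when the policy `π` is run on the sequence `ω` of queries and costs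
(`ω t` belongs to round `t + 1`): a cost is observed only on a cache miss. -/
def cacheHistory {Q : Type*} [DecidableEq Q] (π : CachePolicy Q) (ω : ℕ → Q × ℝ) :
    ℕ → CacheHistory Q
  | 0 => []
  | t + 1 =>
    ((ω t).1, if (ω t).1 ∈ π (cacheHistory π ω t) then none else some (ω t).2) ::
      cacheHistory π ω t

/-- The regret of the policy `π` over `T` rounds, relative to the cache `Lstar`. -/
noncomputable def cacheRegret {Q : Type*} [Fintype Q] [DecidableEq Q] [MeasurableSpace Q]
    (I : CacheInstance Q) (π : CachePolicy Q) (Lstar : Finset Q) (T : ℕ) : ℝ :=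
  ∑ t ∈ Finset.range T,
    ∫ ω, (I.cost (ω t).1 (π (cacheHistory π ω t)) - I.cost (ω t).1 Lstar) ∂I.trajectoryLaw

/-- The empirical frequency of the query `q`. -/
noncomputable def denEst {Q : Type*} [DecidableEq Q] (H : CacheHistory Q) (q : Q) : ℝ :=
  (H.countP fun e => e.1 = q : ℕ) / (H.length : ℝ)

/-- The list of the observed costs of the query `q`. -/
def observedCosts {Q : Type*} [DecidableEq Q] (H : CacheHistory Q) (q : Q) : List ℝ :=
  H.filterMap fun e => if e.1 = q then e.2 else none

/-- The pessimistic (lower confidence bound) estimate of the cost of the query `q`. -/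
noncomputable def regEst {Q : Type*} [Fintype Q] [DecidableEq Q] (B₁ B₂ : ℝ) (T : ℕ) (δ : ℝ)
    (H : CacheHistory Q) (q : Q) : ℝ :=
  if (observedCosts H q).length = 0 then B₁
  else max B₁ ((observedCosts H q).sum / (observedCosts H q).length -
    (B₂ - B₁) * √(Real.log (6 * T * Fintype.card Q / δ) / (2 * (observedCosts H q).length)))

/-- The estimated expected cost of a query, by which the algorithm ranks the queries. -/
noncomputable def estValue {Q : Type*} [Fintype Q] [DecidableEq Q] (B₁ B₂ : ℝ) (T : ℕ) (δ : ℝ)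
    (H : CacheHistory Q) (q : Q) : ℝ :=
  denEst H q * regEst B₁ B₂ T δ H q

/-- The elements of `S` at which `v` is minimal on `S`. -/
noncomputable def cacheMinimizers {Q : Type*} (v : Q → ℝ) (S : Finset Q) : Finset Q :=
  S.filter fun q => ∀ q' ∈ S, v q ≤ v q'

/-- The online caching algorithm with cache size `L`, horizon `T` and confidence parameter `δ`.
`tie qs M` is the element that is evicted when `M` is the set of all minimizers and `qs` is the list
of the queries received so far. -/
noncomputable def onlineCaching {Q : Type*} [Fintype Q] [DecidableEq Q] (L : ℕ) (B₁ B₂ : ℝ)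
    (T : ℕ) (δ : ℝ) (tie : List Q → Finset Q → Q) : CachePolicy Q
  | [] => ∅
  | e :: H =>
    let S := onlineCaching L B₁ B₂ T δ tie H
    let v := estValue B₁ B₂ T δ (e :: H)
    if e.1 ∈ S then S
    else if S.card < L then insert e.1 S
    else if ∃ q ∈ S, v q < v e.1 then
      insert e.1 (S.erase (tie ((e :: H).map Prod.fst) (cacheMinimizers v S)))
    else S

/-- The law on the two points `a` and `b` that gives mass `p` to `b`; for `a = 0` and `b = 1` it is
the Bernoulli law with parameter `p`. -/
noncomputable def twoPointLaw (a b p : ℝ) : Measure ℝ :=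
  ENNReal.ofReal p • Measure.dirac b + ENNReal.ofReal (1 - p) • Measure.dirac a

/-!
**Upper bound.** The estimated value of a query after `t` rounds is `N q * ĉ q / t`, with `N q`
its number of arrivals and `ĉ q` its pessimistic cost estimate. While a query sits in the cache
its costs are not observed, so `ĉ q` is frozen and `N q * ĉ q` can only grow; for a query outside
the cache this product changes only when that query arrives, and then the algorithm compares it
with the cache. So at all times the cache consists of the queries of largest estimated value
(`IsGreedyCache`, `isGreedyCache_onlineCaching`).

Hence the excess cost of the cache over the optimal one is at most the sum of estimation errors
(`expectedCost_sub_le`). Because the cost estimates are pessimistic, a cost error is only paid for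
a query `q` of the optimal cache that is currently not cached. Such a query is observed with
probability `P q` per round, which is also the weight of its error, so that these errors add up to
`∑ k < T, O((B₂ - B₁) √(log / k))` per query of the optimal cache (`sum_integral_missCount_le`).
The frequency errors of the at most `2 * L` queries concerned are `O(L / √t)` in expectation, by
Cauchy–Schwarz and the variance of `N q`, since the variances sum to at most `t` over all queries
(`integral_sum_abs_frequency_le`). That all confidence intervals for the costs hold with
probability at least `1 - 1 / (3 * T)` follows from an exponential supermartingale for the first
`m` observed costs of a query (`measure_deviation_le`); only one event per pair of `m` and a
query, and sign, enters the union bound, although the time of the `m`-th observation is random.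
Altogether the regret is `O(L * B₂ * √(T * log (T * |Q|)))`, from which both stated upper bounds
follow.

**Lower bound.** Take two equally frequent queries, one with success probability `1 / 2 + ε` for
the cost `B₂` and the other with `1 / 2 - ε`, where `ε = 1 / (4 * √T)`. The two ways of assigning
these cost laws cannot be told apart within `T` rounds even if all costs are shown: the
Bhattacharyya coefficient of the two laws of `T` rounds is `(1 - 4 * ε ^ 2) ^ (T / 2)`, which
bounds their overlap from below (`sum_min_roundWeight_ge`). In each round a cache of size one
misses the expensive query of one of the two instances, at an excess cost of `ε * (B₂ - B₁)`, so
one of the two has regret of order `(B₂ - B₁) * √T`.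

In the upper bound, independence of the rounds enters only through the fact that replacing one
coordinate of an i.i.d. sequence by an independent copy preserves its law
(`map_update_infinitePi`).
-/

/-! ### Resampling one coordinate of an i.i.d. sequence -/

section Resampling

variable {X : Type*} [MeasurableSpace X]

theorem measurable_update_prod (t : ℕ) :
    Measurable fun p : (ℕ → X) × X => Function.update p.1 t p.2 := by
  refine measurable_pi_iff.2 fun i => ?_
  by_cases h : i = t
  · subst h; simpa using measurable_snd
  · simp only [Function.update_of_ne h]
    exact (measurable_pi_apply i).comp measurable_fst

/-- Replacing one coordinate of an i.i.d. sequence by an independent copy does not change the law of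
the sequence.  This is the form in which independence of the rounds is used throughout. -/
theorem map_update_infinitePi (ν : Measure X) [IsProbabilityMeasure ν] (t : ℕ) :
    ((Measure.infinitePi fun _ : ℕ => ν).prod ν).map (fun p => Function.update p.1 t p.2) =
      Measure.infinitePi fun _ : ℕ => ν := by
  refine Measure.eq_infinitePi _ fun s A hA => ?_
  rw [Measure.map_apply (measurable_update_prod t)
    (MeasurableSet.pi s.countable_toSet fun i _ => hA i)]
  have hpre : (fun p : (ℕ → X) × X => Function.update p.1 t p.2) ⁻¹' (Set.pi s A) =
      (Set.pi (s.erase t) A) ×ˢ (if t ∈ s then A t else Set.univ) := by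
    ext p
    simp only [Set.mem_preimage, Set.mem_pi, Set.mem_prod, Finset.coe_erase, Finset.mem_coe,
      Set.mem_sdiff, Set.mem_singleton_iff]
    constructor
    · intro h
      refine ⟨fun i hi => by simpa [Function.update_of_ne hi.2] using h i hi.1, ?_⟩
      split_ifs with hts
      · simpa using h t hts
      · trivial
    · rintro ⟨h₁, h₂⟩ i hi
      by_cases hit : i = t
      · subst hit; simpa [hi] using h₂
      · simpa [Function.update_of_ne hit] using h₁ i ⟨hi, hit⟩
  rw [hpre, Measure.prod_prod, Measure.infinitePi_pi _ fun i _ => hA i]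
  split_ifs with hts
  · rw [mul_comm, Finset.mul_prod_erase s (fun i => ν (A i)) hts]
  · rw [measure_univ, mul_one, Finset.erase_eq_of_notMem hts]

theorem lintegral_resample (ν : Measure X) [IsProbabilityMeasure ν] (t : ℕ)
    {F : (ℕ → X) → ENNReal} (hF : Measurable F) :
    ∫⁻ ω, F ω ∂(Measure.infinitePi fun _ : ℕ => ν) =
      ∫⁻ ω, ∫⁻ x, F (Function.update ω t x) ∂ν ∂(Measure.infinitePi fun _ : ℕ => ν) := by
  conv_lhs => rw [← map_update_infinitePi ν t]
  rw [lintegral_map hF (measurable_update_prod t),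
    lintegral_prod (fun p : (ℕ → X) × X => F (Function.update p.1 t p.2))
      (hF.comp (measurable_update_prod t)).aemeasurable]

theorem integral_resample (ν : Measure X) [IsProbabilityMeasure ν] (t : ℕ)
    {F : (ℕ → X) → ℝ} (hF : Integrable F (Measure.infinitePi fun _ : ℕ => ν)) :
    ∫ ω, F ω ∂(Measure.infinitePi fun _ : ℕ => ν) =
      ∫ ω, ∫ x, F (Function.update ω t x) ∂ν ∂(Measure.infinitePi fun _ : ℕ => ν) := by
  have hF' := hF
  rw [← map_update_infinitePi ν t] at hF'
  conv_lhs => rw [← map_update_infinitePi ν t]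
  rw [integral_map (measurable_update_prod t).aemeasurable hF'.aestronglyMeasurable,
    integral_prod (fun p : (ℕ → X) × X => F (Function.update p.1 t p.2))
      ((integrable_map_measure hF'.aestronglyMeasurable
      (measurable_update_prod t).aemeasurable).1 hF')]

end Resampling

/-! ### The law of one round -/

namespace CacheInstance

variable {Q : Type*}

theorem sum_toReal_P [Fintype Q] (I : CacheInstance Q) : ∑ q, (I.P q).toReal = 1 := by
  rw [← ENNReal.toReal_sum fun q _ => I.P.apply_ne_top q, ← tsum_fintype (L := .unconditional Q),
    I.P.tsum_coe, ENNReal.toReal_one]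

variable [Fintype Q] [MeasurableSpace Q]

theorem lintegral_roundLaw (I : CacheInstance Q) {f : Q × ℝ → ENNReal}
    (hf : Measurable f) :
    ∫⁻ x, f x ∂I.roundLaw = ∑ q, I.P q * ∫⁻ c, f (q, c) ∂I.costLaw q := by
  simp only [roundLaw, lintegral_finsetSum_measure, lintegral_smul_measure, smul_eq_mul]
  refine Finset.sum_congr rfl fun q _ => ?_
  rw [lintegral_map hf measurable_prodMk_left]

theorem integral_fst_roundLaw [DiscreteMeasurableSpace Q] (I : CacheInstance Q)
    (f : Q → ℝ) :
    ∫ x, f x.1 ∂I.roundLaw = ∑ q, (I.P q).toReal * f q := by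
  have hm : Measurable fun x : Q × ℝ => f x.1 := (measurable_of_finite f).comp measurable_fst
  have hp := I.isProbability_costLaw
  have hmap (q : Q) : IsProbabilityMeasure ((I.costLaw q).map (Prod.mk q)) :=
    Measure.isProbabilityMeasure_map measurable_prodMk_left.aemeasurable
  rw [roundLaw, integral_finsetSum_measure]
  · refine Finset.sum_congr rfl fun q _ => ?_
    rw [integral_smul_measure, integral_map measurable_prodMk_left.aemeasurable
      hm.aestronglyMeasurable]
    simp
  · intro q _
    refine Integrable.smul_measure ?_ (I.P.apply_ne_top q)
    refine Integrable.of_bound hm.aestronglyMeasurable (∑ q, ‖f q‖) (.of_forall fun x => ?_)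
    exact Finset.single_le_sum (f := fun q => ‖f q‖) (fun _ _ => norm_nonneg _) (Finset.mem_univ _)

instance (I : CacheInstance Q) : IsProbabilityMeasure I.trajectoryLaw := by
  unfold trajectoryLaw; infer_instance

end CacheInstance

/-! ### Histories -/

section History

variable {Q : Type*} [DecidableEq Q]

theorem cacheHistory_congr (π : CachePolicy Q) {ω ω' : ℕ → Q × ℝ} {t : ℕ}
    (h : ∀ i < t, ω i = ω' i) : cacheHistory π ω t = cacheHistory π ω' t := by
  induction t with
  | zero => rfl
  | succ t ih => simp only [cacheHistory, ih fun i hi => h i (by omega), h t (by omega)]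

theorem cacheHistory_update (π : CachePolicy Q) (ω : ℕ → Q × ℝ) (t : ℕ) (x : Q × ℝ) :
    cacheHistory π (Function.update ω t x) t = cacheHistory π ω t :=
  cacheHistory_congr π fun _ hi => Function.update_of_ne hi.ne _ _

@[simp] theorem length_cacheHistory (π : CachePolicy Q) (ω : ℕ → Q × ℝ) (t : ℕ) :
    (cacheHistory π ω t).length = t := by
  induction t with
  | zero => rfl
  | succ t ih => simp [cacheHistory, ih]

/-- The number of rounds in which the query `q` arrived. -/
def queryCount (H : CacheHistory Q) (q : Q) : ℕ := H.countP fun e => e.1 = q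

theorem queryCount_cons (e : Q × Option ℝ) (H : CacheHistory Q) (q : Q) :
    queryCount (e :: H) q = queryCount H q + if e.1 = q then 1 else 0 := by
  simp [queryCount, List.countP_cons]

theorem queryCount_cacheHistory_succ (π : CachePolicy Q) (ω : ℕ → Q × ℝ) (t : ℕ) (q : Q) :
    queryCount (cacheHistory π ω (t + 1)) q =
      queryCount (cacheHistory π ω t) q + if (ω t).1 = q then 1 else 0 := by
  rw [cacheHistory, queryCount_cons]

theorem observedCosts_cons (e : Q × Option ℝ) (H : CacheHistory Q) (q : Q) :
    observedCosts (e :: H) q =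
      (if e.1 = q then e.2 else none).toList ++ observedCosts H q := by
  unfold observedCosts
  rw [List.filterMap_cons]
  cases (if e.1 = q then e.2 else none) <;> rfl

theorem observedCosts_cacheHistory_succ (π : CachePolicy Q) (ω : ℕ → Q × ℝ) (t : ℕ) (q : Q) :
    observedCosts (cacheHistory π ω (t + 1)) q =
      if (ω t).1 = q ∧ q ∉ π (cacheHistory π ω t) then
        (ω t).2 :: observedCosts (cacheHistory π ω t) q
      else observedCosts (cacheHistory π ω t) q := by
  rw [cacheHistory, observedCosts_cons]
  by_cases h : (ω t).1 = q
  · by_cases h' : q ∈ π (cacheHistory π ω t) <;> simp [h, h']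
  · simp [h]

/-- The sum of the last `m` entries of `l`.  Since histories list the newest round first, applied to
`observedCosts H q` this is the sum of the first `m` observed costs of `q` (of all of them, if there
are fewer than `m`). -/
def lastSum (m : ℕ) (l : List ℝ) : ℝ := (l.drop (l.length - m)).sum

theorem lastSum_cons (m : ℕ) (c : ℝ) (l : List ℝ) :
    lastSum m (c :: l) = if l.length < m then c + lastSum m l else lastSum m l := by
  unfold lastSum
  split_ifs with h
  · rw [List.length_cons, Nat.sub_eq_zero_of_le h, Nat.sub_eq_zero_of_le h.le]; simp
  · rw [List.length_cons, Nat.succ_sub (not_lt.1 h)]; simp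

theorem lastSum_of_length_le {m : ℕ} {l : List ℝ} (h : l.length ≤ m) : lastSum m l = l.sum := by
  simp [lastSum, Nat.sub_eq_zero_of_le h]

/-- Once `m` costs of `q` have been observed, the sum of the first `m` of them is final. -/
theorem lastSum_observedCosts_eq (π : CachePolicy Q) (ω : ℕ → Q × ℝ) (q : Q) {s t m : ℕ}
    (hst : s ≤ t) (hm : (observedCosts (cacheHistory π ω s) q).length = m) :
    m ≤ (observedCosts (cacheHistory π ω t) q).length ∧
      lastSum m (observedCosts (cacheHistory π ω t) q) =
        (observedCosts (cacheHistory π ω s) q).sum := by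
  induction t, hst using Nat.le_induction with
  | base => exact ⟨hm.ge, lastSum_of_length_le hm.le⟩
  | succ t _ ih =>
    rw [observedCosts_cacheHistory_succ]
    split_ifs with h
    · rw [lastSum_cons, if_neg (not_lt.2 ih.1), List.length_cons]
      exact ⟨by omega, ih.2⟩
    · exact ih

theorem length_observedCosts_le (π : CachePolicy Q) (ω : ℕ → Q × ℝ) (q : Q) (t : ℕ) :
    (observedCosts (cacheHistory π ω t) q).length ≤ t := by
  have := List.length_filterMap_le (fun e : Q × Option ℝ => if e.1 = q then e.2 else none)
    (cacheHistory π ω t)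
  simpa [observedCosts] using this

theorem queryCount_cacheHistory_le (π : CachePolicy Q) (ω : ℕ → Q × ℝ) (q : Q) (t : ℕ) :
    queryCount (cacheHistory π ω t) q ≤ t := by
  simpa [queryCount] using (List.countP_le_length (p := fun e : Q × Option ℝ => decide (e.1 = q))
    (l := cacheHistory π ω t))

end History

/-! ### Measurability along the trajectory -/

/-- A function of the sample that also depends on a random finite set is integrable if it is so for
every fixed value of the set. -/
theorem integrable_comp_finset {Q : Type*} [Fintype Q] [DecidableEq Q] {Ω : Type*}
    [MeasurableSpace Ω] {μ : Measure Ω}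
    {S : Ω → Finset Q} (hS : ∀ q, NullMeasurableSet {ω | q ∈ S ω} μ)
    {f : Finset Q → Ω → ℝ} (hf : ∀ A, Integrable (f A) μ) :
    Integrable (fun ω => f (S ω) ω) μ := by
  have hSA (A : Finset Q) : NullMeasurableSet {ω | S ω = A} μ := by
    have : {ω | S ω = A} = ⋂ q, {ω | q ∈ S ω ↔ q ∈ A} := by
      ext ω; simp [Finset.ext_iff]
    rw [this]
    refine NullMeasurableSet.iInter fun q => ?_
    by_cases hq : q ∈ A
    · simpa [hq] using hS q
    · simp only [hq, iff_false]
      exact (hS q).compl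
  have : (fun ω => f (S ω) ω) = fun ω => ∑ A, {ω | S ω = A}.indicator (f A) ω := by
    ext ω
    rw [Finset.sum_eq_single (S ω)]
    · simp
    · intro A _ hA; simp [Ne.symm hA]
    · simp
  rw [this]
  exact integrable_finsetSum _ fun A _ => (hf A).indicator₀ (hSA A)

section Measurability

variable {Q : Type*} [Fintype Q] [MeasurableSpace Q] [DiscreteMeasurableSpace Q]

theorem measurableSet_query_eq (t : ℕ) (q : Q) :
    MeasurableSet {ω : ℕ → Q × ℝ | (ω t).1 = q} :=
  (measurable_fst.comp (measurable_pi_apply t)) (measurableSet_singleton q)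

variable [DecidableEq Q]

theorem measurable_queryCount (π : CachePolicy Q) (t : ℕ) (q : Q) :
    Measurable fun ω => queryCount (cacheHistory π ω t) q := by
  induction t with
  | zero => exact measurable_const
  | succ t ih =>
    simp only [queryCount_cacheHistory_succ]
    exact ih.add (Measurable.ite (measurableSet_query_eq t q) measurable_const measurable_const)

theorem measurableSet_miss {π : CachePolicy Q} {t : ℕ} {q : Q}
    (h : MeasurableSet {ω | q ∈ π (cacheHistory π ω t)}) :
    MeasurableSet {ω : ℕ → Q × ℝ | (ω t).1 = q ∧ q ∉ π (cacheHistory π ω t)} :=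
  (measurableSet_query_eq t q).inter h.compl

theorem measurable_length_observedCosts {π : CachePolicy Q} {t : ℕ} {q : Q}
    (h : ∀ s < t, MeasurableSet {ω | q ∈ π (cacheHistory π ω s)}) :
    Measurable fun ω => (observedCosts (cacheHistory π ω t) q).length := by
  induction t with
  | zero => exact measurable_const
  | succ t ih =>
    have ih' := ih fun s hs => h s (by omega)
    simp only [observedCosts_cacheHistory_succ, apply_ite List.length, List.length_cons]
    exact Measurable.ite (measurableSet_miss (h t (by omega))) (ih'.add_const 1) ih'

theorem measurable_lastSum_observedCosts {π : CachePolicy Q} {t : ℕ} {q : Q} (m : ℕ)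
    (h : ∀ s < t, MeasurableSet {ω | q ∈ π (cacheHistory π ω s)}) :
    Measurable fun ω => lastSum m (observedCosts (cacheHistory π ω t) q) := by
  induction t with
  | zero => simp only [cacheHistory, measurable_const]
  | succ t ih =>
    have h' := fun s (hs : s < t) => h s (by omega)
    have hlen := measurable_length_observedCosts h'
    simp only [observedCosts_cacheHistory_succ, apply_ite (lastSum m), lastSum_cons]
    refine Measurable.ite (measurableSet_miss (h t (by omega))) (Measurable.ite ?_ ?_ (ih h'))
      (ih h')
    · exact hlen (MeasurableSet.of_discrete (s := Set.Iio m))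
    · exact (measurable_snd.comp (measurable_pi_apply t)).add (ih h')

theorem measurable_sum_observedCosts {π : CachePolicy Q} {t : ℕ} {q : Q}
    (h : ∀ s < t, MeasurableSet {ω | q ∈ π (cacheHistory π ω s)}) :
    Measurable fun ω => (observedCosts (cacheHistory π ω t) q).sum := by
  have := measurable_lastSum_observedCosts t h
  simpa only [lastSum_of_length_le (length_observedCosts_le π _ q t)] using this

theorem measurable_estValue {π : CachePolicy Q} (B₁ B₂ : ℝ) (T : ℕ) (δ : ℝ) {t : ℕ} {q : Q}
    (h : ∀ s < t, MeasurableSet {ω | q ∈ π (cacheHistory π ω s)}) :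
    Measurable fun ω => estValue B₁ B₂ T δ (cacheHistory π ω t) q := by
  have hlen := measurable_length_observedCosts h
  have hlen' : Measurable fun ω => ((observedCosts (cacheHistory π ω t) q).length : ℝ) :=
    measurable_from_top.comp hlen
  have hcount : Measurable fun ω => (queryCount (cacheHistory π ω t) q : ℝ) :=
    measurable_from_top.comp (measurable_queryCount π t q)
  unfold estValue denEst regEst
  simp only [length_cacheHistory]
  refine (hcount.div_const _).mul (Measurable.ite ?_ measurable_const ?_)
  · exact hlen (measurableSet_singleton 0)
  · refine measurable_const.max (((measurable_sum_observedCosts h).div hlen').sub ?_)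
    exact ((measurable_const.div (hlen'.const_mul 2)).sqrt).const_mul _

end Measurability

/-! ### Expectations along the trajectory -/

section Expectations

variable {Q : Type*} [Fintype Q] [MeasurableSpace Q] [DiscreteMeasurableSpace Q]

theorem integrable_query (I : CacheInstance Q) (t : ℕ) (f : Q → ℝ) :
    Integrable (fun ω => f (ω t).1) I.trajectoryLaw := by
  refine Integrable.of_bound (Measurable.aestronglyMeasurable ?_) (∑ q, ‖f q‖)
    (.of_forall fun ω => ?_)
  · exact (measurable_of_finite f).comp (measurable_fst.comp (measurable_pi_apply t))
  · exact Finset.single_le_sum (f := fun q => ‖f q‖) (fun _ _ => norm_nonneg _) (Finset.mem_univ _)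

variable [DecidableEq Q]

/-- The query of a round is independent of the cache of that round. -/
theorem integral_cost (I : CacheInstance Q) (π : CachePolicy Q) (t : ℕ)
    (hπ : ∀ q, NullMeasurableSet {ω | q ∈ π (cacheHistory π ω t)} I.trajectoryLaw) :
    ∫ ω, I.cost (ω t).1 (π (cacheHistory π ω t)) ∂I.trajectoryLaw =
      ∫ ω, I.expectedCost (π (cacheHistory π ω t)) ∂I.trajectoryLaw := by
  have hint : Integrable (fun ω => I.cost (ω t).1 (π (cacheHistory π ω t))) I.trajectoryLaw :=
    integrable_comp_finset (f := fun A ω => I.cost (ω t).1 A) hπ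
      fun A => integrable_query I t fun q => I.cost q A
  rw [CacheInstance.trajectoryLaw, integral_resample _ t hint]
  simp only [cacheHistory_update, Function.update_self]
  refine integral_congr_ae (.of_forall fun ω => ?_)
  exact I.integral_fst_roundLaw fun q => I.cost q (π (cacheHistory π ω t))

theorem cacheRegret_eq (I : CacheInstance Q) (π : CachePolicy Q) (Lstar : Finset Q) (T : ℕ)
    (hπ : ∀ t q, NullMeasurableSet {ω | q ∈ π (cacheHistory π ω t)} I.trajectoryLaw) :
    cacheRegret I π Lstar T = ∑ t ∈ Finset.range T,
      ∫ ω, (I.expectedCost (π (cacheHistory π ω t)) - I.expectedCost Lstar) ∂I.trajectoryLaw := by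
  refine Finset.sum_congr rfl fun t _ => ?_
  rw [integral_sub, integral_sub, integral_cost I π t (hπ t)]
  · congr 1
    have hint := integrable_query I t fun q => I.cost q Lstar
    rw [CacheInstance.trajectoryLaw, integral_resample _ t hint]
    simp only [Function.update_self]
    rw [I.integral_fst_roundLaw fun q => I.cost q Lstar]
    simp [CacheInstance.expectedCost]
  · exact integrable_comp_finset (f := fun A _ => I.expectedCost A) (hπ t)
      fun A => integrable_const _
  · exact integrable_const _
  · exact integrable_comp_finset (f := fun A ω => I.cost (ω t).1 A) (hπ t)
      fun A => integrable_query I t fun q => I.cost q A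
  · exact integrable_query I t fun q => I.cost q Lstar

theorem integrable_indicator_missCount (I : CacheInstance Q) {π : CachePolicy Q} {t : ℕ} {q : Q}
    (hπ : ∀ s ≤ t, MeasurableSet {ω | q ∈ π (cacheHistory π ω s)}) (g : ℕ → ℝ)
    {p : (ℕ → Q × ℝ) → Prop} [DecidablePred p] (hp : MeasurableSet {ω | p ω}) :
    Integrable (fun ω => if p ω then g (observedCosts (cacheHistory π ω t) q).length else 0)
      I.trajectoryLaw := by
  have hlen := measurable_length_observedCosts fun s (hs : s < t) => hπ s hs.le
  refine Integrable.of_bound (Measurable.aestronglyMeasurable ?_)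
    (∑ k ∈ Finset.range (t + 1), ‖g k‖) (.of_forall fun ω => ?_)
  · exact Measurable.ite hp (measurable_from_top.comp hlen) measurable_const
  · have h₁ : ‖g (observedCosts (cacheHistory π ω t) q).length‖ ≤
        ∑ k ∈ Finset.range (t + 1), ‖g k‖ :=
      Finset.single_le_sum (f := fun k => ‖g k‖) (fun _ _ => norm_nonneg _)
        (Finset.mem_range.2 (Nat.lt_succ_of_le (length_observedCosts_le π ω q t)))
    split_ifs
    · exact h₁
    · simpa using Finset.sum_nonneg fun k _ => norm_nonneg (g k)

/-- While `q` is outside the cache, each round yields an observation of its cost with probability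
`P q`.  So a weight depending on the number of observations accumulates at most once per value of
that number. -/
theorem sum_integral_missCount_le (I : CacheInstance Q) {π : CachePolicy Q} {q : Q}
    (hπ : ∀ t, MeasurableSet {ω | q ∈ π (cacheHistory π ω t)}) {g : ℕ → ℝ} (hg : ∀ k, 0 ≤ g k)
    (T : ℕ) :
    ∑ t ∈ Finset.range T, ∫ ω, (if q ∉ π (cacheHistory π ω t) then
        (I.P q).toReal * g (observedCosts (cacheHistory π ω t) q).length else 0) ∂I.trajectoryLaw ≤
      ∑ k ∈ Finset.range T, g k := by
  have hint (t : ℕ) := integrable_indicator_missCount I (t := t) (fun s _ => hπ s) g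
    (measurableSet_miss (hπ t))
  have hstep (t : ℕ) : ∫ ω, (if q ∉ π (cacheHistory π ω t) then
        (I.P q).toReal * g (observedCosts (cacheHistory π ω t) q).length else 0) ∂I.trajectoryLaw =
      ∫ ω, (if (ω t).1 = q ∧ q ∉ π (cacheHistory π ω t) then
        g (observedCosts (cacheHistory π ω t) q).length else 0) ∂I.trajectoryLaw := by
    conv_rhs => rw [CacheInstance.trajectoryLaw, integral_resample _ t (hint t)]
    simp only [cacheHistory_update, Function.update_self]
    refine integral_congr_ae (.of_forall fun ω => ?_)
    dsimp only
    rw [I.integral_fst_roundLaw fun x => if x = q ∧ q ∉ π (cacheHistory π ω t) then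
        g (observedCosts (cacheHistory π ω t) q).length else 0]
    by_cases h : q ∈ π (cacheHistory π ω t) <;> simp [h]
  have hpt (ω : ℕ → Q × ℝ) (T : ℕ) :
      ∑ t ∈ Finset.range T, (if (ω t).1 = q ∧ q ∉ π (cacheHistory π ω t) then
        g (observedCosts (cacheHistory π ω t) q).length else 0) =
      ∑ k ∈ Finset.range (observedCosts (cacheHistory π ω T) q).length, g k := by
    induction T with
    | zero => simp [cacheHistory, observedCosts]
    | succ T ih =>
      rw [Finset.sum_range_succ, ih, observedCosts_cacheHistory_succ]
      split_ifs
      · rw [List.length_cons, Finset.sum_range_succ]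
      · rw [add_zero]
  simp only [hstep]
  rw [← integral_finsetSum _ fun t _ => hint t]
  calc _ ≤ ∫ ω, (∑ k ∈ Finset.range T, g k) ∂I.trajectoryLaw := by
        refine integral_mono (integrable_finsetSum _ fun t _ => hint t) (integrable_const _)
          fun ω => ?_
        dsimp only
        rw [hpt ω T]
        exact Finset.sum_le_sum_of_subset_of_nonneg
          (Finset.range_mono (length_observedCosts_le π ω q T)) fun k _ _ => hg k
    _ = _ := by simp

theorem integrable_sq_queryCount (I : CacheInstance Q) (π : CachePolicy Q) (t : ℕ) (q : Q)
    (a : ℝ) :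
    Integrable (fun ω => ((queryCount (cacheHistory π ω t) q : ℝ) - a) ^ 2) I.trajectoryLaw := by
  have hcount : Measurable fun ω => (queryCount (cacheHistory π ω t) q : ℝ) :=
    measurable_from_top.comp (measurable_queryCount π t q)
  refine Integrable.of_bound ((hcount.sub_const a).pow_const 2).aestronglyMeasurable
    ((t + |a|) ^ 2) (.of_forall fun ω => ?_)
  rw [norm_pow, Real.norm_eq_abs]
  have h₁ := abs_sub (queryCount (cacheHistory π ω t) q : ℝ) a
  have h₂ : (queryCount (cacheHistory π ω t) q : ℝ) ≤ t := by
    exact_mod_cast queryCount_cacheHistory_le π ω q t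
  rw [Nat.abs_cast] at h₁
  gcongr
  linarith

/-- The variance of the number of arrivals of `q`. -/
theorem integral_sq_queryCount (I : CacheInstance Q) (π : CachePolicy Q) (t : ℕ) (q : Q) :
    ∫ ω, ((queryCount (cacheHistory π ω t) q : ℝ) - t * (I.P q).toReal) ^ 2 ∂I.trajectoryLaw =
      t * ((I.P q).toReal * (1 - (I.P q).toReal)) := by
  induction t with
  | zero => simp [cacheHistory, queryCount]
  | succ t ih =>
    set p := (I.P q).toReal with hp
    have hint := integrable_sq_queryCount I π (t + 1) q ((t + 1 : ℕ) * p)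
    have hsq := integrable_sq_queryCount I π t q (t * p)
    rw [CacheInstance.trajectoryLaw, integral_resample _ t hint]
    have hinner (ω : ℕ → Q × ℝ) :
        ∫ x, ((queryCount (cacheHistory π (Function.update ω t x) (t + 1)) q : ℝ) -
          (t + 1 : ℕ) * p) ^ 2 ∂I.roundLaw =
        ((queryCount (cacheHistory π ω t) q : ℝ) - t * p) ^ 2 + p * (1 - p) := by
      simp only [queryCount_cacheHistory_succ, cacheHistory_update, Function.update_self]
      rw [I.integral_fst_roundLaw fun x =>
        (((queryCount (cacheHistory π ω t) q + if x = q then 1 else 0 : ℕ) : ℝ) -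
          (t + 1 : ℕ) * p) ^ 2]
      have hsum : ∑ x ∈ Finset.univ.erase q, (I.P x).toReal = 1 - p := by
        rw [hp, ← I.sum_toReal_P, ← Finset.add_sum_erase _ _ (Finset.mem_univ q)]; ring
      rw [← Finset.add_sum_erase _ _ (Finset.mem_univ q)]
      have herase : ∑ x ∈ Finset.univ.erase q, (I.P x).toReal *
          (((queryCount (cacheHistory π ω t) q + if x = q then 1 else 0 : ℕ) : ℝ) -
            (t + 1 : ℕ) * p) ^ 2 =
          (1 - p) * ((queryCount (cacheHistory π ω t) q : ℝ) - (t + 1 : ℕ) * p) ^ 2 := by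
        rw [← hsum, Finset.sum_mul]
        refine Finset.sum_congr rfl fun x hx => ?_
        rw [if_neg (Finset.ne_of_mem_erase hx), add_zero]
      rw [herase, if_pos rfl, ← hp]
      push_cast
      ring
    simp only [hinner]
    rw [← CacheInstance.trajectoryLaw, integral_add hsq (integrable_const _), ih]
    simp only [integral_const, probReal_univ, smul_eq_mul, one_mul]
    push_cast
    ring

end Expectations

/-! ### The online caching algorithm keeps the queries of largest estimated value -/

section Algorithm

theorem mem_cacheMinimizers {Q : Type*} {v : Q → ℝ} {S : Finset Q} {q : Q} :
    q ∈ cacheMinimizers v S ↔ q ∈ S ∧ ∀ q' ∈ S, v q ≤ v q' := by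
  simp [cacheMinimizers]

variable {Q : Type*} [DecidableEq Q]

theorem queryCount_div_length_cons (H : CacheHistory Q) (q : Q) :
    (queryCount H q : ℝ) / ((H.length : ℝ) + 1) =
      queryCount H q / H.length * (H.length / (H.length + 1)) := by
  rcases eq_or_ne H.length 0 with h | h
  · simp [List.length_eq_zero_iff.1 h, queryCount]
  · have : (H.length : ℝ) ≠ 0 := by exact_mod_cast h
    field_simp

variable [Fintype Q]

theorem le_regEst (B₁ B₂ : ℝ) (T : ℕ) (δ : ℝ) (H : CacheHistory Q) (q : Q) :
    B₁ ≤ regEst B₁ B₂ T δ H q := by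
  unfold regEst
  split_ifs
  exacts [le_rfl, le_max_left _ _]

theorem estValue_eq (B₁ B₂ : ℝ) (T : ℕ) (δ : ℝ) (H : CacheHistory Q) (q : Q) :
    estValue B₁ B₂ T δ H q = queryCount H q / H.length * regEst B₁ B₂ T δ H q := rfl

theorem estValue_nonneg {B₁ : ℝ} (hB₁ : 0 ≤ B₁) (B₂ : ℝ) (T : ℕ) (δ : ℝ) (H : CacheHistory Q)
    (q : Q) : 0 ≤ estValue B₁ B₂ T δ H q :=
  mul_nonneg (div_nonneg (Nat.cast_nonneg _) (Nat.cast_nonneg _)) (hB₁.trans (le_regEst ..))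

/-- A round changes the estimated values of all queries other than the arriving one by a common
factor, so it does not change their order. -/
theorem estValue_cons_of_ne (B₁ B₂ : ℝ) (T : ℕ) (δ : ℝ) {e : Q × Option ℝ} (H : CacheHistory Q)
    {q : Q} (h : e.1 ≠ q) :
    estValue B₁ B₂ T δ (e :: H) q =
      estValue B₁ B₂ T δ H q * (H.length / ((H.length : ℝ) + 1)) := by
  have hobs : observedCosts (e :: H) q = observedCosts H q := by simp [observedCosts_cons, h]
  rw [estValue_eq, estValue_eq, queryCount_cons, if_neg h, add_zero, List.length_cons,
    Nat.cast_add_one, queryCount_div_length_cons, regEst, regEst, hobs]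
  ring

/-- On a hit the cost estimate of the arriving query does not change, while its frequency grows. -/
theorem le_estValue_cons_hit {B₁ : ℝ} (hB₁ : 0 ≤ B₁) (B₂ : ℝ) (T : ℕ) (δ : ℝ)
    {e : Q × Option ℝ} (H : CacheHistory Q) (h : e.2 = none) :
    estValue B₁ B₂ T δ H e.1 * (H.length / ((H.length : ℝ) + 1)) ≤
      estValue B₁ B₂ T δ (e :: H) e.1 := by
  have hobs : observedCosts (e :: H) e.1 = observedCosts H e.1 := by simp [observedCosts_cons, h]
  have hreg : regEst B₁ B₂ T δ (e :: H) e.1 = regEst B₁ B₂ T δ H e.1 := by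
    rw [regEst, regEst, hobs]
  rw [estValue_eq, estValue_eq, queryCount_cons, if_pos rfl, List.length_cons,
    Nat.cast_add_one, hreg, mul_right_comm, ← queryCount_div_length_cons]
  refine mul_le_mul_of_nonneg_right ?_ (hB₁.trans (le_regEst ..))
  rw [Nat.cast_add_one]
  gcongr
  linarith

/-- The invariant of the algorithm: every cached query has at least the estimated value of every
query outside the cache, and a cache that is not full contains all queries received so far. -/
structure IsGreedyCache (L : ℕ) (B₁ B₂ : ℝ) (T : ℕ) (δ : ℝ) (H : CacheHistory Q)
    (S : Finset Q) : Prop where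
  card_le : S.card ≤ L
  count_eq_zero : S.card < L → ∀ q ∉ S, queryCount H q = 0
  estValue_le : ∀ q ∈ S, ∀ q' ∉ S, estValue B₁ B₂ T δ H q' ≤ estValue B₁ B₂ T δ H q

theorem isGreedyCache_cons {L : ℕ} {B₁ B₂ : ℝ} {T : ℕ} {δ : ℝ} (hB₁ : 0 ≤ B₁)
    {tie : List Q → Finset Q → Q} (htie : ∀ qs M, M.Nonempty → tie qs M ∈ M)
    {H : CacheHistory Q} {e : Q × Option ℝ}
    (ih : IsGreedyCache L B₁ B₂ T δ H (onlineCaching L B₁ B₂ T δ tie H))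
    (he : e.1 ∈ onlineCaching L B₁ B₂ T δ tie H → e.2 = none) :
    IsGreedyCache L B₁ B₂ T δ (e :: H) (onlineCaching L B₁ B₂ T δ tie (e :: H)) := by
  rw [onlineCaching]
  set S := onlineCaching L B₁ B₂ T δ tie H
  set v := estValue B₁ B₂ T δ (e :: H) with hv
  have hr : (0 : ℝ) ≤ H.length / ((H.length : ℝ) + 1) := by positivity
  have hne {q q' : Q} (hq : q ∈ S) (hq' : q' ∉ S) (h : e.1 ≠ q) (h' : e.1 ≠ q') : v q' ≤ v q := by
    rw [hv, estValue_cons_of_ne _ _ _ _ _ h, estValue_cons_of_ne _ _ _ _ _ h']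
    exact mul_le_mul_of_nonneg_right (ih.estValue_le q hq q' hq') hr
  split_ifs with hit hcard hswap
  · refine ⟨ih.card_le, fun hc q hq => ?_, fun q hq q' hq' => ?_⟩
    · rw [queryCount_cons, ih.count_eq_zero hc q hq, if_neg fun h : e.1 = q => hq (h ▸ hit)]
    · have h' : e.1 ≠ q' := fun h => hq' (h ▸ hit)
      by_cases h : e.1 = q
      · subst h
        rw [estValue_cons_of_ne _ _ _ _ _ h']
        exact (mul_le_mul_of_nonneg_right (ih.estValue_le _ hq q' hq') hr).trans
          (le_estValue_cons_hit hB₁ _ _ _ _ (he hit))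
      · exact hne hq hq' h h'
  · have hzero (q : Q) (hq : q ∉ insert e.1 S) : queryCount (e :: H) q = 0 := by
      rw [Finset.mem_insert, not_or] at hq
      rw [queryCount_cons, ih.count_eq_zero hcard q hq.2, if_neg (Ne.symm hq.1)]
    refine ⟨(Finset.card_insert_le _ _).trans hcard, fun _ => hzero, fun q _ q' hq' => ?_⟩
    rw [estValue_eq, hzero q' hq']
    simpa using estValue_nonneg hB₁ ..
  · set z := tie (List.map Prod.fst (e :: H)) (cacheMinimizers v S)
    obtain ⟨q₀, hq₀, hlt⟩ := hswap
    have hz : z ∈ cacheMinimizers v S := by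
      refine htie _ _ ?_
      obtain ⟨q₁, hq₁, hmin⟩ := S.exists_min_image v ⟨q₀, hq₀⟩
      exact ⟨q₁, mem_cacheMinimizers.2 ⟨hq₁, hmin⟩⟩
    obtain ⟨hzS, hzmin⟩ := mem_cacheMinimizers.1 hz
    have hcard' : (insert e.1 (S.erase z)).card = S.card := by
      rw [Finset.card_insert_of_notMem fun h => hit (Finset.mem_of_mem_erase h),
        Finset.card_erase_add_one hzS]
    refine ⟨hcard'.trans_le ih.card_le, fun h => absurd (hcard' ▸ h) hcard,
      fun q hq q' hq' => ?_⟩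
    -- The evicted query separates the old values from the new ones.
    have h₁ : v z ≤ v q := by
      rcases Finset.mem_insert.1 hq with rfl | hq
      · exact (hzmin q₀ hq₀).trans hlt.le
      · exact hzmin q (Finset.mem_of_mem_erase hq)
    have h₂ : v q' ≤ v z := by
      rw [Finset.mem_insert, not_or, Finset.mem_erase, not_and_or, not_not] at hq'
      rcases hq'.2 with rfl | hq'S
      · rfl
      · exact hne hzS hq'S (fun h => hit (h ▸ hzS)) (Ne.symm hq'.1)
    exact h₂.trans h₁
  · refine ⟨ih.card_le, fun h => absurd h hcard, fun q hq q' hq' => ?_⟩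
    push Not at hswap
    by_cases h : e.1 = q'
    · subst h; exact hswap q hq
    · exact hne hq hq' (fun h => hit (h ▸ hq)) h

theorem isGreedyCache_onlineCaching {B₁ : ℝ} (hB₁ : 0 ≤ B₁) (L : ℕ) (B₂ : ℝ) (T : ℕ) (δ : ℝ)
    {tie : List Q → Finset Q → Q} (htie : ∀ qs M, M.Nonempty → tie qs M ∈ M)
    (ω : ℕ → Q × ℝ) (t : ℕ) :
    IsGreedyCache L B₁ B₂ T δ (cacheHistory (onlineCaching L B₁ B₂ T δ tie) ω t)
      (onlineCaching L B₁ B₂ T δ tie (cacheHistory (onlineCaching L B₁ B₂ T δ tie) ω t)) := by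
  induction t with
  | zero => exact ⟨by simp [cacheHistory, onlineCaching], fun _ _ _ => rfl,
      fun q hq => by simp [cacheHistory, onlineCaching] at hq⟩
  | succ t ih => exact isGreedyCache_cons hB₁ htie ih fun h => if_pos h

/-! ### Measurability of the caches of the algorithm -/

/-- One step of the algorithm, as a function of the queries received so far, of the current cache
and of the set `R` of the pairs of queries that are weakly ordered by their estimated values.  All
three take countably many values. -/
def cacheStep (L : ℕ) (tie : List Q → Finset Q → Q) :
    List Q × Finset Q × Finset (Q × Q) → Finset Q
  | ([], _, _) => ∅
  | (x :: l, S, R) =>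
    if x ∈ S then S
    else if S.card < L then insert x S
    else if ∃ q ∈ S, (x, q) ∉ R then
      insert x (S.erase (tie (x :: l) (S.filter fun q => ∀ q' ∈ S, (q, q') ∈ R)))
    else S

theorem onlineCaching_cons (L : ℕ) (B₁ B₂ : ℝ) (T : ℕ) (δ : ℝ) (tie : List Q → Finset Q → Q)
    (e : Q × Option ℝ) (H : CacheHistory Q) :
    onlineCaching L B₁ B₂ T δ tie (e :: H) =
      cacheStep L tie ((e :: H).map Prod.fst, onlineCaching L B₁ B₂ T δ tie H,
        Finset.univ.filter fun p : Q × Q =>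
          estValue B₁ B₂ T δ (e :: H) p.1 ≤ estValue B₁ B₂ T δ (e :: H) p.2) := by
  simp only [onlineCaching, cacheStep, List.map_cons, Finset.mem_filter, Finset.mem_univ, true_and,
    not_le, cacheMinimizers]
  congr!

theorem measurableSet_of_countable_fibers {Ω ι : Type*} [MeasurableSpace Ω] [Countable ι]
    {f : Ω → ι} (hf : ∀ i, MeasurableSet {ω | f ω = i}) (p : ι → Prop) :
    MeasurableSet {ω | p (f ω)} := by
  have : {ω | p (f ω)} = ⋃ i ∈ {i | p i}, {ω | f ω = i} := by ext ω; simp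
  rw [this]
  exact MeasurableSet.biUnion (Set.to_countable _) fun i _ => hf i

variable [MeasurableSpace Q] [DiscreteMeasurableSpace Q]

theorem measurableSet_queries_eq (π : CachePolicy Q) (t : ℕ) (l : List Q) :
    MeasurableSet {ω | (cacheHistory π ω t).map Prod.fst = l} := by
  induction t generalizing l with
  | zero => simp [cacheHistory]
  | succ t ih =>
    cases l with
    | nil => simp [cacheHistory]
    | cons x l =>
      simp only [cacheHistory, List.map_cons, List.cons.injEq]
      exact (measurableSet_query_eq t x).inter (ih l)

theorem measurableSet_mem_onlineCaching (L : ℕ) (B₁ B₂ : ℝ) (T : ℕ) (δ : ℝ)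
    (tie : List Q → Finset Q → Q) (t : ℕ) (q : Q) :
    MeasurableSet {ω | q ∈ onlineCaching L B₁ B₂ T δ tie
      (cacheHistory (onlineCaching L B₁ B₂ T δ tie) ω t)} := by
  set π := onlineCaching L B₁ B₂ T δ tie with hπ
  induction t using Nat.strong_induction_on generalizing q with
  | _ t ih =>
  rcases t with _ | t
  · simp [cacheHistory, hπ, onlineCaching]
  · have hstep (ω : ℕ → Q × ℝ) : π (cacheHistory π ω (t + 1)) =
        cacheStep L tie ((cacheHistory π ω (t + 1)).map Prod.fst, π (cacheHistory π ω t),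
          Finset.univ.filter fun p : Q × Q =>
            estValue B₁ B₂ T δ (cacheHistory π ω (t + 1)) p.1 ≤
              estValue B₁ B₂ T δ (cacheHistory π ω (t + 1)) p.2) :=
      onlineCaching_cons ..
    simp only [hstep]
    refine measurableSet_of_countable_fibers (fun i => ?_) fun i => q ∈ cacheStep L tie i
    obtain ⟨l, S, R⟩ := i
    simp only [Prod.mk.injEq]
    refine (measurableSet_queries_eq π (t + 1) l).inter (MeasurableSet.inter ?_ ?_)
    · simp only [Finset.ext_iff]
      refine measurableSet_setOfPred.2 (Measurable.forall fun q => measurableSet_setOfPred.1 ?_)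
      exact (ih t (by omega) q).iff (MeasurableSet.const _)
    · simp only [Finset.ext_iff, Finset.mem_filter, Finset.mem_univ, true_and]
      refine measurableSet_setOfPred.2 (Measurable.forall fun p => measurableSet_setOfPred.1 ?_)
      refine MeasurableSet.iff ?_ (MeasurableSet.const _)
      exact measurableSet_le (measurable_estValue _ _ _ _ fun s hs => ih s hs _)
        (measurable_estValue _ _ _ _ fun s hs => ih s hs _)

end Algorithm

/-! ### The regret of one round -/

section OneRound

variable {Q : Type*} [Fintype Q] [DecidableEq Q]

/-- The width of the confidence interval for a mean cost after `k` observations. -/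
noncomputable def confRadius (B₁ B₂ a : ℝ) (k : ℕ) : ℝ := (B₂ - B₁) * √(a / (2 * k))

/-- How far the pessimistic cost estimate can lie below the mean cost after `k` observations. -/
noncomputable def pessimismGap (B₁ B₂ a : ℝ) (k : ℕ) : ℝ :=
  if k = 0 then B₂ - B₁ else 2 * confRadius B₁ B₂ a k

/-- After the history `H`, the mean costs of all observed queries lie in their confidence
intervals. -/
def CostsConcentrated (I : CacheInstance Q) (B₁ B₂ a : ℝ) (H : CacheHistory Q) : Prop :=
  ∀ q, (observedCosts H q).length ≠ 0 →
    |(observedCosts H q).sum / (observedCosts H q).length - I.meanCost q| ≤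
      confRadius B₁ B₂ a (observedCosts H q).length

theorem CostsConcentrated.regEst_le {I : CacheInstance Q} {B₁ B₂ δ : ℝ} {T : ℕ}
    {H : CacheHistory Q}
    (h : CostsConcentrated I B₁ B₂ (Real.log (6 * T * Fintype.card Q / δ)) H) {q : Q}
    (hq : B₁ ≤ I.meanCost q) : regEst B₁ B₂ T δ H q ≤ I.meanCost q := by
  unfold regEst
  split_ifs with h0
  · exact hq
  · have := (abs_le.1 (h q h0)).2
    unfold confRadius at this
    exact max_le hq (by linarith)

theorem CostsConcentrated.meanCost_sub_regEst_le {I : CacheInstance Q} {B₁ B₂ δ : ℝ} {T : ℕ}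
    {H : CacheHistory Q}
    (h : CostsConcentrated I B₁ B₂ (Real.log (6 * T * Fintype.card Q / δ)) H) {q : Q}
    (hq : I.meanCost q ≤ B₂) :
    I.meanCost q - regEst B₁ B₂ T δ H q ≤
      pessimismGap B₁ B₂ (Real.log (6 * T * Fintype.card Q / δ)) (observedCosts H q).length := by
  unfold regEst pessimismGap
  split_ifs with h0
  · linarith
  · have h₁ := (abs_le.1 (h q h0)).1
    have h₂ := le_max_right B₁ ((observedCosts H q).sum / (observedCosts H q).length -
      confRadius B₁ B₂ (Real.log (6 * T * Fintype.card Q / δ)) (observedCosts H q).length)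
    unfold confRadius at *
    linarith

theorem pessimismGap_nonneg {B₁ B₂ : ℝ} (h : B₁ ≤ B₂) (a : ℝ) (k : ℕ) :
    0 ≤ pessimismGap B₁ B₂ a k := by
  have : 0 ≤ B₂ - B₁ := sub_nonneg.2 h
  unfold pessimismGap confRadius
  split_ifs <;> positivity

namespace CacheInstance

theorem expectedCost_eq (I : CacheInstance Q) (S : Finset Q) :
    I.expectedCost S =
      ∑ q, (I.P q).toReal * I.meanCost q - ∑ q ∈ S, (I.P q).toReal * I.meanCost q := by
  rw [eq_sub_iff_add_eq, ← Finset.sum_ite_mem_eq (s := S), expectedCost,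
    ← Finset.sum_add_distrib]
  refine Finset.sum_congr rfl fun q _ => ?_
  unfold cost
  split_ifs <;> simp

theorem expectedCost_nonneg {I : CacheInstance Q} (h : ∀ q, 0 ≤ I.meanCost q) (S : Finset Q) :
    0 ≤ I.expectedCost S := by
  refine Finset.sum_nonneg fun q _ => mul_nonneg ENNReal.toReal_nonneg ?_
  unfold cost
  split_ifs
  exacts [le_rfl, h q]

theorem expectedCost_le {I : CacheInstance Q} {B : ℝ} (hB : 0 ≤ B) (h : ∀ q, I.meanCost q ≤ B)
    (S : Finset Q) : I.expectedCost S ≤ B := by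
  calc I.expectedCost S ≤ ∑ q, (I.P q).toReal * B := by
        refine Finset.sum_le_sum fun q _ => mul_le_mul_of_nonneg_left ?_ ENNReal.toReal_nonneg
        unfold cost
        split_ifs
        exacts [hB, h q]
    _ = B := by rw [← Finset.sum_mul, I.sum_toReal_P, one_mul]

end CacheInstance

theorem sum_le_sum_of_forall_le {α : Type*} {A B : Finset α} {v : α → ℝ} (hv : ∀ a, 0 ≤ v a)
    (hAB : ∀ a ∈ A, ∀ b ∈ B, v a ≤ v b) (hcard : A.card ≤ B.card ∨ ∀ a ∈ A, v a = 0) :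
    ∑ a ∈ A, v a ≤ ∑ b ∈ B, v b := by
  rcases hcard with hcard | h0
  · rcases A.eq_empty_or_nonempty with rfl | hA
    · simpa using Finset.sum_nonneg fun b _ => hv b
    obtain ⟨a₀, ha₀, hmax⟩ := A.exists_max_image v hA
    calc ∑ a ∈ A, v a ≤ A.card • v a₀ := Finset.sum_le_card_nsmul _ _ _ hmax
      _ ≤ B.card • v a₀ := nsmul_le_nsmul_left (hv a₀) hcard
      _ ≤ ∑ b ∈ B, v b := Finset.card_nsmul_le_sum _ _ _ fun b hb => hAB a₀ ha₀ b hb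
  · rw [Finset.sum_eq_zero h0]
    exact Finset.sum_nonneg fun b _ => hv b

/-- Since a greedy cache carries at least the estimated value of the optimal one, its expected
excess cost is at most the estimation errors: pessimism makes the cost errors count only for the
queries of the optimal cache that are not cached, which are those whose costs are being observed. -/
theorem expectedCost_sub_le {I : CacheInstance Q} {L : ℕ} {B₁ B₂ δ : ℝ} {T : ℕ}
    {H : CacheHistory Q} {S Lstar : Finset Q} (hB₁ : 0 ≤ B₁)
    (hI : ∀ q, I.meanCost q ∈ Set.Icc B₁ B₂) (hS : IsGreedyCache L B₁ B₂ T δ H S)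
    (hH : CostsConcentrated I B₁ B₂ (Real.log (6 * T * Fintype.card Q / δ)) H)
    (hL : Lstar.card ≤ L) :
    I.expectedCost S - I.expectedCost Lstar ≤
      ∑ q ∈ Lstar, (if q ∉ S then (I.P q).toReal * pessimismGap B₁ B₂
          (Real.log (6 * T * Fintype.card Q / δ)) (observedCosts H q).length else 0) +
        B₂ * ∑ q ∈ S ∪ Lstar, |queryCount H q / H.length - (I.P q).toReal| := by
  set a := Real.log (6 * T * Fintype.card Q / δ)
  set d : Q → ℝ := fun q => |queryCount H q / H.length - (I.P q).toReal|
  set v := estValue B₁ B₂ T δ H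
  have hP (q : Q) : 0 ≤ (I.P q).toReal := ENNReal.toReal_nonneg
  have hv : ∑ q ∈ Lstar \ S, v q ≤ ∑ q ∈ S \ Lstar, v q := by
    refine sum_le_sum_of_forall_le (fun q => estValue_nonneg hB₁ ..) (fun q hq q' hq' => ?_) ?_
    · exact hS.estValue_le q' (Finset.mem_sdiff.1 hq').1 q (Finset.mem_sdiff.1 hq).2
    · rcases lt_or_ge S.card L with hlt | hge
      · refine Or.inr fun q hq => ?_
        simp [v, estValue_eq, hS.count_eq_zero hlt q (Finset.mem_sdiff.1 hq).2]
      · exact Or.inl (Finset.card_sdiff_le_card_sdiff_iff.2 (hL.trans hge))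
  have hout (q : Q) : (I.P q).toReal * I.meanCost q ≤
      v q + (I.P q).toReal * pessimismGap B₁ B₂ a (observedCosts H q).length + B₂ * d q := by
    have h₁ := mul_le_mul_of_nonneg_left (hH.meanCost_sub_regEst_le (hI q).2) (hP q)
    have h₂ : ((I.P q).toReal - queryCount H q / H.length) * regEst B₁ B₂ T δ H q ≤ B₂ * d q := by
      calc _ ≤ d q * regEst B₁ B₂ T δ H q := by
            refine mul_le_mul_of_nonneg_right ?_ (hB₁.trans (le_regEst ..))
            exact (le_abs_self _).trans (abs_sub_comm _ _).le
        _ ≤ d q * B₂ := mul_le_mul_of_nonneg_left ((hH.regEst_le (hI q).1).trans (hI q).2)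
            (abs_nonneg _)
        _ = B₂ * d q := mul_comm _ _
    have h₃ : v q = queryCount H q / H.length * regEst B₁ B₂ T δ H q := rfl
    linarith
  have hin (q : Q) : v q ≤ (I.P q).toReal * I.meanCost q + B₂ * d q := by
    have hc : 0 ≤ I.meanCost q := hB₁.trans (hI q).1
    calc v q = queryCount H q / H.length * regEst B₁ B₂ T δ H q := rfl
      _ ≤ queryCount H q / H.length * I.meanCost q :=
          mul_le_mul_of_nonneg_left (hH.regEst_le (hI q).1) (by positivity)
      _ ≤ ((I.P q).toReal + d q) * I.meanCost q := by
          refine mul_le_mul_of_nonneg_right ?_ hc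
          linarith [le_abs_self (queryCount H q / H.length - (I.P q).toReal)]
      _ ≤ _ := by
          have := mul_le_mul_of_nonneg_left (hI q).2 (abs_nonneg
            (queryCount H q / H.length - (I.P q).toReal))
          simp only [d]
          linarith
  have hd : ∑ q ∈ Lstar \ S, d q + ∑ q ∈ S \ Lstar, d q ≤ ∑ q ∈ S ∪ Lstar, d q := by
    rw [← Finset.sum_union (Finset.disjoint_left.2 fun q h h' =>
      (Finset.mem_sdiff.1 h).2 (Finset.mem_sdiff.1 h').1)]
    refine Finset.sum_le_sum_of_subset_of_nonneg (fun q => ?_) fun q _ _ => abs_nonneg _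
    simp only [Finset.mem_union, Finset.mem_sdiff]
    tauto
  have hB₂ : 0 ≤ B₂ := by
    rcases isEmpty_or_nonempty Q with hQ | ⟨⟨q⟩⟩
    · exact absurd I.sum_toReal_P (by simp)
    · exact hB₁.trans ((hI q).1.trans (hI q).2)
  have hfilter : ∑ q ∈ Lstar, (if q ∉ S then (I.P q).toReal * pessimismGap B₁ B₂ a
      (observedCosts H q).length else 0) = ∑ q ∈ Lstar \ S, (I.P q).toReal *
        pessimismGap B₁ B₂ a (observedCosts H q).length := by
    rw [← Finset.sum_filter, Finset.sdiff_eq_filter]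
  have h₁ := Finset.sum_le_sum fun q (_ : q ∈ Lstar \ S) => hout q
  have h₂ := Finset.sum_le_sum fun q (_ : q ∈ S \ Lstar) => hin q
  have h₃ := Finset.sum_sdiff_sub_sum_sdiff (s₁ := S) (s₂ := Lstar)
    (f := fun q => (I.P q).toReal * I.meanCost q)
  have h₄ := mul_le_mul_of_nonneg_left hd hB₂
  simp only [Finset.sum_add_distrib, ← Finset.mul_sum, mul_add] at h₁ h₂ h₃ h₄
  rw [I.expectedCost_eq, I.expectedCost_eq, hfilter]
  linarith

end OneRound

/-! ### Concentration of the observed costs -/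

section Concentration

variable {Q : Type*}

/-- The exponent of the exponential supermartingale of the first `m` observed costs of `q`. -/
noncomputable def deviationExponent (I : CacheInstance Q) (B₁ B₂ l : ℝ) (m : ℕ) (q : Q)
    (obs : List ℝ) : ℝ :=
  l * (lastSum m obs - (min obs.length m : ℕ) * I.meanCost q) -
    l ^ 2 * (B₂ - B₁) ^ 2 / 8 * (min obs.length m : ℕ)

theorem deviationExponent_cons_of_lt (I : CacheInstance Q) (B₁ B₂ l : ℝ) {m : ℕ} (q : Q) (c : ℝ)
    {obs : List ℝ} (h : obs.length < m) :
    deviationExponent I B₁ B₂ l m q (c :: obs) = deviationExponent I B₁ B₂ l m q obs +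
      (l * (c - I.meanCost q) - l ^ 2 * (B₂ - B₁) ^ 2 / 8) := by
  have h₁ : min (c :: obs).length m = obs.length + 1 := by simp; omega
  have h₂ : min obs.length m = obs.length := by omega
  rw [deviationExponent, deviationExponent, lastSum_cons, if_pos h, h₁, h₂]
  push_cast
  ring

theorem deviationExponent_cons_of_le (I : CacheInstance Q) (B₁ B₂ l : ℝ) {m : ℕ} (q : Q) (c : ℝ)
    {obs : List ℝ} (h : m ≤ obs.length) :
    deviationExponent I B₁ B₂ l m q (c :: obs) = deviationExponent I B₁ B₂ l m q obs := by
  have h₁ : min (c :: obs).length m = m := by simp; omega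
  have h₂ : min obs.length m = m := by omega
  rw [deviationExponent, deviationExponent, lastSum_cons, if_neg (not_lt.2 h), h₁, h₂]

/-- Hoeffding's lemma for the cost of one query. -/
theorem lintegral_exp_cost_le (I : CacheInstance Q) {B₁ B₂ : ℝ} {q : Q}
    (hI : ∀ᵐ x ∂I.costLaw q, x ∈ Set.Icc B₁ B₂) (l : ℝ) :
    ∫⁻ c, ENNReal.ofReal (Real.exp (l * (c - I.meanCost q) - l ^ 2 * (B₂ - B₁) ^ 2 / 8))
      ∂I.costLaw q ≤ 1 := by
  have hp := I.isProbability_costLaw q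
  have hsub : ProbabilityTheory.HasSubgaussianMGF (fun c => c - I.meanCost q)
      ((‖B₂ - B₁‖₊ / 2) ^ 2) (I.costLaw q) :=
    ProbabilityTheory.hasSubgaussianMGF_of_mem_Icc (X := fun c => c) aemeasurable_id hI
  have hmgf := hsub.mgf_le l
  have hint := hsub.integrable_exp_mul l
  have hconst : (((‖B₂ - B₁‖₊ / 2) ^ 2 : NNReal) : ℝ) * l ^ 2 / 2 =
      l ^ 2 * (B₂ - B₁) ^ 2 / 8 := by
    push_cast
    rw [div_pow, Real.norm_eq_abs, sq_abs]
    ring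
  rw [hconst, ProbabilityTheory.mgf] at hmgf
  simp only [Real.exp_sub _ (l ^ 2 * (B₂ - B₁) ^ 2 / 8)]
  rw [← ofReal_integral_eq_lintegral_ofReal (hint.div_const _)
    (.of_forall fun c => by positivity), integral_div, ← ENNReal.ofReal_one]
  refine ENNReal.ofReal_le_ofReal ?_
  rw [div_le_one (Real.exp_pos _)]
  exact hmgf

variable [Fintype Q] [DecidableEq Q] [MeasurableSpace Q] [DiscreteMeasurableSpace Q]

theorem measurable_deviationExponent (I : CacheInstance Q) {π : CachePolicy Q} (B₁ B₂ l : ℝ)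
    (m : ℕ) {q : Q} (hπ : ∀ t, MeasurableSet {ω | q ∈ π (cacheHistory π ω t)}) (t : ℕ) :
    Measurable fun ω => ENNReal.ofReal (Real.exp
      (deviationExponent I B₁ B₂ l m q (observedCosts (cacheHistory π ω t) q))) := by
  have hlen : Measurable fun ω =>
      ((min (observedCosts (cacheHistory π ω t) q).length m : ℕ) : ℝ) :=
    measurable_from_top.comp ((measurable_length_observedCosts fun s _ => hπ s).min
      measurable_const)
  have hsum := measurable_lastSum_observedCosts (t := t) m fun s _ => hπ s
  unfold deviationExponent
  exact (((hsum.sub (hlen.mul_const _)).const_mul l).sub (hlen.const_mul _)).exp.ennreal_ofReal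

theorem lintegral_deviationExponent_le_one (I : CacheInstance Q) {π : CachePolicy Q} {B₁ B₂ : ℝ}
    (l : ℝ) (m : ℕ) {q : Q} (hI : ∀ᵐ x ∂I.costLaw q, x ∈ Set.Icc B₁ B₂)
    (hπ : ∀ t, MeasurableSet {ω | q ∈ π (cacheHistory π ω t)}) (t : ℕ) :
    ∫⁻ ω, ENNReal.ofReal (Real.exp (deviationExponent I B₁ B₂ l m q
      (observedCosts (cacheHistory π ω t) q))) ∂I.trajectoryLaw ≤ 1 := by
  induction t with
  | zero => simp [cacheHistory, observedCosts, deviationExponent, lastSum]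
  | succ t ih =>
    refine le_trans ?_ ih
    have hmeas := measurable_deviationExponent I B₁ B₂ l m hπ (t + 1)
    rw [CacheInstance.trajectoryLaw, lintegral_resample _ t hmeas]
    refine lintegral_mono fun ω => ?_
    rw [I.lintegral_roundLaw (f := fun x => ENNReal.ofReal (Real.exp (deviationExponent I B₁ B₂ l m
      q (observedCosts (cacheHistory π (Function.update ω t x) (t + 1)) q))))
      (hmeas.comp (measurable_update ω))]
    simp only [observedCosts_cacheHistory_succ, cacheHistory_update, Function.update_self]
    set obs := observedCosts (cacheHistory π ω t) q
    set E := ENNReal.ofReal (Real.exp (deviationExponent I B₁ B₂ l m q obs)) with hE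
    have hle (q' : Q) : ∫⁻ c, ENNReal.ofReal (Real.exp (deviationExponent I B₁ B₂ l m q
        (if q' = q ∧ q ∉ π (cacheHistory π ω t) then c :: obs else obs))) ∂I.costLaw q' ≤ E := by
      have hp := I.isProbability_costLaw q'
      by_cases h : q' = q ∧ q ∉ π (cacheHistory π ω t)
      · simp only [if_pos h]
        rcases lt_or_ge obs.length m with hlt | hge
        · simp only [deviationExponent_cons_of_lt I B₁ B₂ l q _ hlt, Real.exp_add,
            ENNReal.ofReal_mul (Real.exp_pos _).le]
          rw [lintegral_const_mul' _ _ ENNReal.ofReal_ne_top, h.1]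
          exact mul_le_of_le_one_right' (lintegral_exp_cost_le I hI l)
        · simp [deviationExponent_cons_of_le I B₁ B₂ l q _ hge, hE]
      · simp [if_neg h, hE]
    calc _ ≤ ∑ q', I.P q' * E := Finset.sum_le_sum fun q' _ => mul_le_mul_right (hle q') _
      _ = E := by
        rw [← Finset.sum_mul, ← tsum_fintype (L := .unconditional Q), I.P.tsum_coe, one_mul]

/-- A maximal Hoeffding inequality: the average of the first `m` observed costs of `q`, whenever the
`m`-th observation happens, is unlikely to deviate from the mean.  The sign of the deviation is
`σ`. -/
theorem measure_deviation_le (I : CacheInstance Q) {π : CachePolicy Q} {B₁ B₂ : ℝ} (hB : B₁ < B₂)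
    {q : Q} (hI : ∀ᵐ x ∂I.costLaw q, x ∈ Set.Icc B₁ B₂)
    (hπ : ∀ t, MeasurableSet {ω | q ∈ π (cacheHistory π ω t)}) (T m : ℕ) {σ r : ℝ}
    (hσ : σ ^ 2 = 1) (hr : 0 ≤ r) :
    I.trajectoryLaw {ω | ∃ t ≤ T, (observedCosts (cacheHistory π ω t) q).length = m ∧
      m * r ≤ σ * ((observedCosts (cacheHistory π ω t) q).sum - m * I.meanCost q)} ≤
      ENNReal.ofReal (Real.exp (-(2 * m * r ^ 2 / (B₂ - B₁) ^ 2))) := by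
  have hΔ : B₂ - B₁ ≠ 0 := (sub_pos.2 hB).ne'
  -- The choice of `l` optimizes the exponent.
  set l := 4 * σ * r / (B₂ - B₁) ^ 2 with hl
  set x := 2 * m * r ^ 2 / (B₂ - B₁) ^ 2 with hx
  have hmarkov := mul_meas_ge_le_lintegral (μ := I.trajectoryLaw)
    (measurable_deviationExponent I B₁ B₂ l m hπ T) (ENNReal.ofReal (Real.exp x))
  have hone := hmarkov.trans (lintegral_deviationExponent_le_one I l m hI hπ T)
  have hsub : {ω | ∃ t ≤ T, (observedCosts (cacheHistory π ω t) q).length = m ∧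
      m * r ≤ σ * ((observedCosts (cacheHistory π ω t) q).sum - m * I.meanCost q)} ⊆
      {ω | ENNReal.ofReal (Real.exp x) ≤ ENNReal.ofReal (Real.exp (deviationExponent I B₁ B₂ l m q
        (observedCosts (cacheHistory π ω T) q)))} := by
    rintro ω ⟨t, htT, hlen, hdev⟩
    obtain ⟨h₁, h₂⟩ := lastSum_observedCosts_eq π ω q htT hlen
    refine ENNReal.ofReal_le_ofReal (Real.exp_le_exp.2 ?_)
    rw [deviationExponent, h₂, min_eq_right h₁]
    have hmul := mul_le_mul_of_nonneg_left hdev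
      (show 0 ≤ 4 * r / (B₂ - B₁) ^ 2 by positivity)
    have h₃ : l ^ 2 * (B₂ - B₁) ^ 2 / 8 * m = x := by
      rw [hl, hx, div_pow, mul_pow, mul_pow, hσ]
      field_simp
      ring
    have h₄ : 4 * r / (B₂ - B₁) ^ 2 * (m * r) = 2 * x := by rw [hx]; ring
    have h₅ : l * ((observedCosts (cacheHistory π ω t) q).sum - m * I.meanCost q) =
        4 * r / (B₂ - B₁) ^ 2 *
          (σ * ((observedCosts (cacheHistory π ω t) q).sum - m * I.meanCost q)) := by
      rw [hl]; ring
    rw [h₃, h₅]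
    linarith
  refine (measure_mono hsub).trans ?_
  rw [Real.exp_neg, ENNReal.ofReal_inv_of_pos (Real.exp_pos _)]
  rw [mul_comm] at hone
  exact (ENNReal.le_inv_iff_mul_le).2 hone

end Concentration

/-! ### The upper bound -/

section UpperBound

theorem CacheInstance.meanCost_mem_Icc {Q : Type*} {I : CacheInstance Q} {B₁ B₂ : ℝ}
    (hI : ∀ q, ∀ᵐ x ∂I.costLaw q, x ∈ Set.Icc B₁ B₂) (q : Q) :
    I.meanCost q ∈ Set.Icc B₁ B₂ := by
  have hp := I.isProbability_costLaw q
  exact (convex_Icc B₁ B₂).integral_mem isClosed_Icc (hI q)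
    (Integrable.of_mem_Icc B₁ B₂ aemeasurable_id (hI q))

variable {Q : Type*} [Fintype Q] [DecidableEq Q] [MeasurableSpace Q] [DiscreteMeasurableSpace Q]

theorem measure_not_costsConcentrated_le {I : CacheInstance Q} {π : CachePolicy Q} {B₁ B₂ : ℝ}
    (hB : B₁ < B₂) (hI : ∀ q, ∀ᵐ x ∂I.costLaw q, x ∈ Set.Icc B₁ B₂)
    (hπ : ∀ t q, MeasurableSet {ω | q ∈ π (cacheHistory π ω t)}) (T : ℕ) {a : ℝ} (ha : 0 ≤ a) :
    I.trajectoryLaw {ω | ∃ t ≤ T, ¬ CostsConcentrated I B₁ B₂ a (cacheHistory π ω t)} ≤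
      ENNReal.ofReal (2 * Fintype.card Q * T * Real.exp (-a)) := by
  have hΔ : 0 < B₂ - B₁ := sub_pos.2 hB
  let bad (q : Q) (m : ℕ) (σ : ℝ) : Set (ℕ → Q × ℝ) :=
    {ω | ∃ t ≤ T, (observedCosts (cacheHistory π ω t) q).length = m ∧
      m * confRadius B₁ B₂ a m ≤
        σ * ((observedCosts (cacheHistory π ω t) q).sum - m * I.meanCost q)}
  have hbad (q : Q) (m : ℕ) (hm : m ∈ Finset.Icc 1 T) (σ : ℝ) (hσ : σ ^ 2 = 1) :
      I.trajectoryLaw (bad q m σ) ≤ ENNReal.ofReal (Real.exp (-a)) := by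
    have hm' : (0 : ℝ) < m := by exact_mod_cast (Finset.mem_Icc.1 hm).1
    refine (measure_deviation_le I hB (hI q) (fun t => hπ t q) T m hσ
      (mul_nonneg hΔ.le (Real.sqrt_nonneg _))).trans_eq ?_
    rw [mul_pow, Real.sq_sqrt (by positivity)]
    congr 3
    field_simp
  have hsub : {ω | ∃ t ≤ T, ¬ CostsConcentrated I B₁ B₂ a (cacheHistory π ω t)} ⊆
      ⋃ q ∈ (Finset.univ : Finset Q), ⋃ m ∈ Finset.Icc 1 T, (bad q m 1 ∪ bad q m (-1)) := by
    rintro ω ⟨t, htT, hnot⟩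
    unfold CostsConcentrated at hnot
    push Not at hnot
    obtain ⟨q, hlen, hdev⟩ := hnot
    simp only [Set.mem_iUnion]
    refine ⟨q, Finset.mem_univ q, _, Finset.mem_Icc.2 ⟨Nat.one_le_iff_ne_zero.2 hlen,
      (length_observedCosts_le π ω q t).trans htT⟩, ?_⟩
    set m := (observedCosts (cacheHistory π ω t) q).length with hm
    have hm' : (0 : ℝ) < m := by exact_mod_cast Nat.pos_of_ne_zero hlen
    have hmul := mul_le_mul_of_nonneg_left hdev.le hm'.le
    have hscale : (m : ℝ) * ((observedCosts (cacheHistory π ω t) q).sum / m - I.meanCost q) =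
        (observedCosts (cacheHistory π ω t) q).sum - m * I.meanCost q := by field_simp
    rw [← abs_of_pos hm', ← abs_mul, abs_of_pos hm', hscale] at hmul
    rcases le_abs.1 hmul with h | h
    · exact Or.inl ⟨t, htT, hm.symm, by rwa [one_mul]⟩
    · exact Or.inr ⟨t, htT, hm.symm, by rwa [neg_one_mul]⟩
  calc _ ≤ I.trajectoryLaw
        (⋃ q ∈ (Finset.univ : Finset Q), ⋃ m ∈ Finset.Icc 1 T, (bad q m 1 ∪ bad q m (-1))) :=
        measure_mono hsub
    _ ≤ ∑ q : Q, ∑ m ∈ Finset.Icc 1 T, I.trajectoryLaw (bad q m 1 ∪ bad q m (-1)) :=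
        (measure_biUnion_finset_le _ _).trans
          (Finset.sum_le_sum fun q _ => measure_biUnion_finset_le _ _)
    _ ≤ ∑ q : Q, ∑ m ∈ Finset.Icc 1 T, 2 * ENNReal.ofReal (Real.exp (-a)) := by
        refine Finset.sum_le_sum fun q _ => Finset.sum_le_sum fun m hm => ?_
        rw [two_mul]
        exact (measure_union_le _ _).trans
          (add_le_add (hbad q m hm 1 (by norm_num)) (hbad q m hm (-1) (by norm_num)))
    _ = _ := by
        rw [Finset.sum_const, Finset.sum_const, Nat.card_Icc, Finset.card_univ, nsmul_eq_mul,
          nsmul_eq_mul, add_tsub_cancel_right, ENNReal.ofReal_mul (by positivity),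
          ENNReal.ofReal_mul (by positivity), ENNReal.ofReal_mul (by positivity)]
        simp only [ENNReal.ofReal_natCast, ENNReal.ofReal_ofNat]
        ring

/-- The frequency errors over a random set of at most `2 * L` queries.  By Cauchy–Schwarz only their
mean square matters, so there is no union bound over the queries. -/
theorem integral_sum_abs_frequency_le (I : CacheInstance Q) {π : CachePolicy Q} {L : ℕ}
    {Lstar : Finset Q} (hcard : ∀ ω t, (π (cacheHistory π ω t)).card ≤ L) (hL : Lstar.card ≤ L)
    (t : ℕ) :
    ∫ ω, ∑ q ∈ π (cacheHistory π ω t) ∪ Lstar,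
      |(queryCount (cacheHistory π ω t) q : ℝ) / (cacheHistory π ω t).length - (I.P q).toReal|
        ∂I.trajectoryLaw ≤ (2 * L + 1) / √(t + 1) := by
  have hP (q : Q) : 0 ≤ (I.P q).toReal := ENNReal.toReal_nonneg
  rcases Nat.eq_zero_or_pos t with rfl | ht
  · have h0 (ω : ℕ → Q × ℝ) : ∑ q ∈ π (cacheHistory π ω 0) ∪ Lstar,
        |(queryCount (cacheHistory π ω 0) q : ℝ) / (cacheHistory π ω 0).length -
          (I.P q).toReal| ≤ 1 := by
      simp only [cacheHistory, List.length_nil, Nat.cast_zero, div_zero, zero_sub, abs_neg,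
        abs_of_nonneg (hP _)]
      rw [← I.sum_toReal_P]
      exact Finset.sum_le_sum_of_subset_of_nonneg (Finset.subset_univ _) fun q _ _ => hP q
    simp only [cacheHistory] at h0 ⊢
    rw [integral_const, probReal_univ, one_smul]
    refine (h0 fun _ => (I.P.support_nonempty.some, 0)).trans ?_
    simp
  · set s := √(t : ℝ) with hs
    have ht' : (0 : ℝ) < t := by exact_mod_cast ht
    have hs0 : 0 < s := Real.sqrt_pos.2 ht'
    have hs2 : s ^ 2 = t := Real.sq_sqrt ht'.le
    have hpt (ω : ℕ → Q × ℝ) : ∑ q ∈ π (cacheHistory π ω t) ∪ Lstar,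
        |(queryCount (cacheHistory π ω t) q : ℝ) / (cacheHistory π ω t).length -
          (I.P q).toReal| ≤
        L / s + ∑ q, ((queryCount (cacheHistory π ω t) q : ℝ) - t * (I.P q).toReal) ^ 2 /
          (2 * s ^ 3) := by
      have hone (q : Q) : |(queryCount (cacheHistory π ω t) q : ℝ) / (cacheHistory π ω t).length -
          (I.P q).toReal| ≤ 1 / (2 * s) +
          ((queryCount (cacheHistory π ω t) q : ℝ) - t * (I.P q).toReal) ^ 2 / (2 * s ^ 3) := by
        rw [length_cacheHistory]
        set y := (queryCount (cacheHistory π ω t) q : ℝ) - t * (I.P q).toReal with hy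
        have hx : (queryCount (cacheHistory π ω t) q : ℝ) / t - (I.P q).toReal = y / s ^ 2 := by
          rw [hy, hs2]; field_simp
        rw [hx, abs_div, abs_of_pos (pow_pos hs0 2), ← sq_abs y]
        have h := sq_nonneg (|y| - s)
        have : 1 / (2 * s) + |y| ^ 2 / (2 * s ^ 3) - |y| / s ^ 2 =
            (|y| - s) ^ 2 / (2 * s ^ 3) := by field_simp; ring
        have h' : 0 ≤ (|y| - s) ^ 2 / (2 * s ^ 3) := by positivity
        linarith
      refine (Finset.sum_le_sum fun q _ => hone q).trans ?_
      rw [Finset.sum_add_distrib]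
      refine add_le_add ?_ (Finset.sum_le_sum_of_subset_of_nonneg (Finset.subset_univ _)
        fun q _ _ => by positivity)
      have hc : (((π (cacheHistory π ω t) ∪ Lstar).card : ℕ) : ℝ) ≤ 2 * L := by
        have := Finset.card_union_le (π (cacheHistory π ω t)) Lstar
        have := hcard ω t
        exact_mod_cast (by omega : (π (cacheHistory π ω t) ∪ Lstar).card ≤ 2 * L)
      rw [Finset.sum_const, nsmul_eq_mul]
      calc _ ≤ 2 * L * (1 / (2 * s)) := mul_le_mul_of_nonneg_right hc (by positivity)
        _ = L / s := by field_simp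
    have hint (q : Q) := (integrable_sq_queryCount I π t q (t * (I.P q).toReal)).div_const
      (2 * s ^ 3)
    have hvar : ∑ q, ((t : ℝ) * ((I.P q).toReal * (1 - (I.P q).toReal))) / (2 * s ^ 3) ≤
        1 / (2 * s) := by
      calc _ ≤ ∑ q, (t : ℝ) * (I.P q).toReal / (2 * s ^ 3) := by
            refine Finset.sum_le_sum fun q _ => ?_
            gcongr
            nlinarith [hP q]
        _ = 1 / (2 * s) := by
            rw [← Finset.sum_div, ← Finset.mul_sum, I.sum_toReal_P, ← hs2]
            field_simp
    calc _ ≤ ∫ ω, (L / s + ∑ q, ((queryCount (cacheHistory π ω t) q : ℝ) -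
            t * (I.P q).toReal) ^ 2 / (2 * s ^ 3)) ∂I.trajectoryLaw := by
          refine integral_mono_of_nonneg
            (.of_forall fun ω => Finset.sum_nonneg fun q _ => abs_nonneg _) ?_
            (.of_forall hpt)
          exact (integrable_const _).add (integrable_finsetSum _ fun q _ => hint q)
      _ = L / s + ∑ q, ((t : ℝ) * ((I.P q).toReal * (1 - (I.P q).toReal))) / (2 * s ^ 3) := by
          rw [integral_add (integrable_const _) (integrable_finsetSum _ fun q _ => hint q),
            integral_finsetSum _ fun q _ => hint q]
          simp only [integral_const, probReal_univ, one_smul, integral_div, integral_sq_queryCount]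
      _ ≤ L / s + 1 / (2 * s) := by gcongr
      _ = (2 * L + 1) / (2 * s) := by field_simp
      _ ≤ (2 * L + 1) / √(t + 1) := by
          refine div_le_div_of_nonneg_left (by positivity) (by positivity) ?_
          rw [Real.sqrt_le_left (by positivity), mul_pow, hs2]
          have : (1 : ℝ) ≤ t := by exact_mod_cast ht
          linarith

theorem sum_one_div_sqrt_succ_le (T : ℕ) :
    ∑ k ∈ Finset.range T, 1 / √((k : ℝ) + 1) ≤ 2 * √T := by
  induction T with
  | zero => simp
  | succ T ih =>
    rw [Finset.sum_range_succ]
    push_cast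
    have h₁ : 0 < √((T : ℝ) + 1) := Real.sqrt_pos.2 (by positivity)
    have h₂ : √((T : ℝ) + 1) ^ 2 = T + 1 := Real.sq_sqrt (by positivity)
    have h₃ : √(T : ℝ) ^ 2 = T := Real.sq_sqrt (by positivity)
    have h₄ : 1 / √((T : ℝ) + 1) ≤ 2 * √((T : ℝ) + 1) - 2 * √T := by
      rw [div_le_iff₀ h₁]
      nlinarith [sq_nonneg (√((T : ℝ) + 1) - √T)]
    linarith

theorem pessimismGap_le {B₁ B₂ a : ℝ} (hB : B₁ ≤ B₂) (ha : 1 ≤ a) (k : ℕ) :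
    pessimismGap B₁ B₂ a k ≤ 4 * (B₂ - B₁) * √a * (1 / √((k : ℝ) + 1)) := by
  have hΔ : 0 ≤ B₂ - B₁ := sub_nonneg.2 hB
  have ha' : 1 ≤ √a := Real.one_le_sqrt.2 ha
  unfold pessimismGap confRadius
  split_ifs with hk
  · subst hk
    simp only [Nat.cast_zero, zero_add, Real.sqrt_one, div_one, mul_one]
    nlinarith
  · have hk' : (1 : ℝ) ≤ k := by exact_mod_cast Nat.one_le_iff_ne_zero.2 hk
    have h : √(a / (2 * k)) ≤ √a * (1 / √((k : ℝ) + 1)) := by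
      rw [mul_one_div, ← Real.sqrt_div (by linarith)]
      refine Real.sqrt_le_sqrt (div_le_div_of_nonneg_left (by linarith) (by linarith) (by linarith))
    nlinarith [mul_nonneg hΔ (Real.sqrt_nonneg (a / (2 * k))), mul_le_mul_of_nonneg_left h hΔ]

theorem sum_pessimismGap_le {B₁ B₂ a : ℝ} (hB : B₁ ≤ B₂) (ha : 1 ≤ a) (T : ℕ) :
    ∑ k ∈ Finset.range T, pessimismGap B₁ B₂ a k ≤ 8 * (B₂ - B₁) * √a * √T := by
  calc _ ≤ ∑ k ∈ Finset.range T, 4 * (B₂ - B₁) * √a * (1 / √((k : ℝ) + 1)) :=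
        Finset.sum_le_sum fun k _ => pessimismGap_le hB ha k
    _ ≤ 4 * (B₂ - B₁) * √a * (2 * √T) := by
        rw [← Finset.mul_sum]
        exact mul_le_mul_of_nonneg_left (sum_one_div_sqrt_succ_le T)
          (mul_nonneg (mul_nonneg (by norm_num) (sub_nonneg.2 hB)) (Real.sqrt_nonneg _))
    _ = _ := by ring

/-- The regret of the algorithm, with an arbitrary confidence parameter. -/
theorem cacheRegret_onlineCaching_le {I : CacheInstance Q} {L T : ℕ} {B₁ B₂ δ : ℝ}
    {tie : List Q → Finset Q → Q} {Lstar : Finset Q} (hB₁ : 0 ≤ B₁) (hB : B₁ < B₂)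
    (hI : ∀ q, ∀ᵐ x ∂I.costLaw q, x ∈ Set.Icc B₁ B₂)
    (htie : ∀ qs M, M.Nonempty → tie qs M ∈ M) (hL : Lstar.card ≤ L)
    (ha : 1 ≤ Real.log (6 * T * Fintype.card Q / δ)) :
    cacheRegret I (onlineCaching L B₁ B₂ T δ tie) Lstar T ≤
      L * (8 * (B₂ - B₁) * √(Real.log (6 * T * Fintype.card Q / δ)) * √T) +
        B₂ * ((2 * L + 1) * (2 * √T)) +
        T * (B₂ * (2 * Fintype.card Q * T *
          Real.exp (-Real.log (6 * T * Fintype.card Q / δ)))) := by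
  set a := Real.log (6 * T * Fintype.card Q / δ) with ha_def
  set π := onlineCaching L B₁ B₂ T δ tie with hπ_def
  have hπ (t : ℕ) (q : Q) : MeasurableSet {ω | q ∈ π (cacheHistory π ω t)} :=
    measurableSet_mem_onlineCaching L B₁ B₂ T δ tie t q
  have hgreedy (ω : ℕ → Q × ℝ) (t : ℕ) :=
    isGreedyCache_onlineCaching hB₁ L B₂ T δ htie ω t
  have hB₂ : 0 ≤ B₂ := hB₁.trans hB.le
  have hmean := CacheInstance.meanCost_mem_Icc hI
  set μ := I.trajectoryLaw with hμ
  -- A measurable set carrying all trajectories on which some confidence interval fails.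
  set bad := toMeasurable μ {ω | ∃ t ≤ T, ¬ CostsConcentrated I B₁ B₂ a (cacheHistory π ω t)}
    with hbad_def
  have hbad_meas : MeasurableSet bad := measurableSet_toMeasurable _ _
  have hbad : μ.real bad ≤ 2 * Fintype.card Q * T * Real.exp (-a) := by
    refine ENNReal.toReal_le_of_le_ofReal (by positivity) ?_
    rw [hbad_def, measure_toMeasurable]
    exact measure_not_costsConcentrated_le hB hI hπ T (by linarith)
  have hgap_int (t : ℕ) (q : Q) := (integrable_indicator_missCount I (t := t) (fun s _ => hπ s q)
    (p := fun ω => q ∉ π (cacheHistory π ω t))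
    (fun k => (I.P q).toReal * pessimismGap B₁ B₂ a k) (hπ t q).compl)
  have hfreq_int (t : ℕ) : Integrable (fun ω => ∑ q ∈ π (cacheHistory π ω t) ∪ Lstar,
      |(queryCount (cacheHistory π ω t) q : ℝ) / (cacheHistory π ω t).length -
        (I.P q).toReal|) μ := by
    refine integrable_comp_finset (f := fun A ω => ∑ q ∈ A ∪ Lstar,
      |(queryCount (cacheHistory π ω t) q : ℝ) / (cacheHistory π ω t).length -
        (I.P q).toReal|) (fun q => (hπ t q).nullMeasurableSet) fun A =>
      integrable_finsetSum _ fun q _ => ?_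
    simp only [length_cacheHistory]
    refine Integrable.abs (Integrable.sub (Integrable.div_const ?_ _) (integrable_const _))
    refine Integrable.of_bound (measurable_from_top.comp
      (measurable_queryCount π t q)).aestronglyMeasurable t (.of_forall fun ω => ?_)
    rw [Real.norm_eq_abs, Nat.abs_cast]
    exact_mod_cast queryCount_cacheHistory_le π ω q t
  have hround (t : ℕ) (ht : t ∈ Finset.range T) :
      ∫ ω, (I.expectedCost (π (cacheHistory π ω t)) - I.expectedCost Lstar) ∂μ ≤
        ∑ q ∈ Lstar, ∫ ω, (if q ∉ π (cacheHistory π ω t) then (I.P q).toReal *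
          pessimismGap B₁ B₂ a (observedCosts (cacheHistory π ω t) q).length else 0) ∂μ +
        B₂ * ((2 * L + 1) * (1 / √((t : ℝ) + 1))) +
        B₂ * (2 * Fintype.card Q * T * Real.exp (-a)) := by
    have hpt (ω : ℕ → Q × ℝ) :
        I.expectedCost (π (cacheHistory π ω t)) - I.expectedCost Lstar ≤
        ∑ q ∈ Lstar, (if q ∉ π (cacheHistory π ω t) then (I.P q).toReal *
          pessimismGap B₁ B₂ a (observedCosts (cacheHistory π ω t) q).length else 0) +
        B₂ * ∑ q ∈ π (cacheHistory π ω t) ∪ Lstar,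
          |(queryCount (cacheHistory π ω t) q : ℝ) / (cacheHistory π ω t).length -
            (I.P q).toReal| +
        B₂ * bad.indicator 1 ω := by
      by_cases hω : ω ∈ bad
      · have h₁ := CacheInstance.expectedCost_le hB₂ (fun q => (hmean q).2)
          (π (cacheHistory π ω t))
        have h₂ := CacheInstance.expectedCost_nonneg (fun q => hB₁.trans (hmean q).1) Lstar
        have h₃ : 0 ≤ ∑ q ∈ Lstar, (if q ∉ π (cacheHistory π ω t) then (I.P q).toReal *
            pessimismGap B₁ B₂ a (observedCosts (cacheHistory π ω t) q).length else 0) := by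
          refine Finset.sum_nonneg fun q _ => ?_
          split_ifs
          exacts [le_rfl, mul_nonneg ENNReal.toReal_nonneg (pessimismGap_nonneg hB.le _ _)]
        have h₄ : 0 ≤ B₂ * ∑ q ∈ π (cacheHistory π ω t) ∪ Lstar,
            |(queryCount (cacheHistory π ω t) q : ℝ) / (cacheHistory π ω t).length -
              (I.P q).toReal| :=
          mul_nonneg hB₂ (Finset.sum_nonneg fun q _ => abs_nonneg _)
        rw [Set.indicator_of_mem hω, Pi.one_apply, mul_one]
        linarith
      · have hgood : CostsConcentrated I B₁ B₂ a (cacheHistory π ω t) := by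
          by_contra h
          exact hω (subset_toMeasurable _ _ ⟨t, (Finset.mem_range.1 ht).le, h⟩)
        rw [Set.indicator_of_notMem hω, mul_zero, add_zero]
        exact expectedCost_sub_le hB₁ hmean (hgreedy ω t) hgood hL
    have hone_int : Integrable (bad.indicator (1 : (ℕ → Q × ℝ) → ℝ)) μ :=
      (integrable_const (1 : ℝ)).indicator hbad_meas
    have hsum_int := integrable_finsetSum Lstar fun q _ => hgap_int t q
    have htwo_int : Integrable (fun ω => ∑ q ∈ Lstar, (if q ∉ π (cacheHistory π ω t) then
        (I.P q).toReal * pessimismGap B₁ B₂ a (observedCosts (cacheHistory π ω t) q).length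
          else 0) + B₂ * ∑ q ∈ π (cacheHistory π ω t) ∪ Lstar,
        |(queryCount (cacheHistory π ω t) q : ℝ) / (cacheHistory π ω t).length -
          (I.P q).toReal|) μ := hsum_int.add ((hfreq_int t).const_mul B₂)
    refine (integral_mono ?_ (htwo_int.add (hone_int.const_mul B₂)) hpt).trans ?_
    · exact (integrable_comp_finset (f := fun A _ => I.expectedCost A)
        (fun q => (hπ t q).nullMeasurableSet) fun A => integrable_const _).sub (integrable_const _)
    · simp only [Pi.add_apply]
      rw [integral_add htwo_int (hone_int.const_mul B₂),
        integral_add hsum_int ((hfreq_int t).const_mul B₂),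
        integral_finsetSum _ fun q _ => hgap_int t q, integral_const_mul, integral_const_mul,
        integral_indicator_one hbad_meas]
      have hfreq := integral_sum_abs_frequency_le I (fun ω t => (hgreedy ω t).card_le) hL t
      rw [mul_one_div]
      gcongr
  rw [cacheRegret_eq I π Lstar T fun t q => (hπ t q).nullMeasurableSet]
  refine (Finset.sum_le_sum hround).trans ?_
  rw [Finset.sum_add_distrib, Finset.sum_add_distrib, Finset.sum_comm, ← Finset.mul_sum,
    ← Finset.mul_sum, Finset.sum_const, Finset.card_range, nsmul_eq_mul]
  have hgap : ∑ q ∈ Lstar, ∑ t ∈ Finset.range T, ∫ ω, (if q ∉ π (cacheHistory π ω t) then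
      (I.P q).toReal * pessimismGap B₁ B₂ a (observedCosts (cacheHistory π ω t) q).length
        else 0) ∂μ ≤ L * (8 * (B₂ - B₁) * √a * √T) := by
    calc _ ≤ ∑ q ∈ Lstar, 8 * (B₂ - B₁) * √a * √T := Finset.sum_le_sum fun q _ =>
          (sum_integral_missCount_le I (fun t => hπ t q) (pessimismGap_nonneg hB.le a) T).trans
            (sum_pessimismGap_le hB.le ha T)
      _ ≤ _ := by
          rw [Finset.sum_const, nsmul_eq_mul]
          have : 0 ≤ B₂ - B₁ := sub_nonneg.2 hB.le
          gcongr
  have hsqrt := sum_one_div_sqrt_succ_le T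
  gcongr

/-- The regret of the algorithm for `δ = 1 / T`.  The factor `B₂ - B₁` of the cost errors is at most
`B₂`, so they are dominated by the frequency errors. -/
theorem cacheRegret_onlineCaching_le_sqrt {I : CacheInstance Q} {L T : ℕ} {B₁ B₂ : ℝ}
    {tie : List Q → Finset Q → Q} {Lstar : Finset Q} (hB₁ : 0 < B₁) (hB : B₁ < B₂)
    (hT : 2 ≤ T * Fintype.card Q)
    (hI : ∀ q, ∀ᵐ x ∂I.costLaw q, x ∈ Set.Icc B₁ B₂)
    (htie : ∀ qs M, M.Nonempty → tie qs M ∈ M) (hL : Lstar.card ≤ L) :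
    cacheRegret I (onlineCaching L B₁ B₂ T (1 / T) tie) Lstar T ≤
      40 * (L * B₂ * √(T * Real.log (T * Fintype.card Q))) := by
  rcases Nat.eq_zero_or_pos L with rfl | hLpos
  · -- A cache of size zero stays empty, as does the optimal one.
    have hempty (ω : ℕ → Q × ℝ) (t : ℕ) := Finset.card_eq_zero.1 (Nat.le_zero.1
      (isGreedyCache_onlineCaching hB₁.le 0 B₂ T (1 / T) htie ω t).card_le)
    have hstar : Lstar = ∅ := Finset.card_eq_zero.1 (Nat.le_zero.1 hL)
    simp only [cacheRegret, hempty, hstar, sub_self, integral_zero, Finset.sum_const_zero]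
    simp
  have hTpos : 0 < T := Nat.pos_of_ne_zero fun h => by simp [h] at hT
  have hnpos : 0 < Fintype.card Q := Nat.pos_of_ne_zero fun h => by simp [h] at hT
  have hT1 : (1 : ℝ) ≤ T := by exact_mod_cast hTpos
  have hn1 : (1 : ℝ) ≤ Fintype.card Q := by exact_mod_cast hnpos
  have hL1 : (1 : ℝ) ≤ L := by exact_mod_cast hLpos
  have hx2 : (2 : ℝ) ≤ T * Fintype.card Q := by exact_mod_cast hT
  set n : ℝ := (Fintype.card Q : ℝ)
  set x : ℝ := T * n with hx
  set ℓ := Real.log x with hℓ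
  have hℓ4 : 1 / 4 ≤ ℓ := by
    have h := Real.log_le_log (by norm_num) hx2
    linarith [Real.log_two_gt_d9]
  have harg : 6 * T * n / (1 / T) = 6 * T ^ 2 * n := by field_simp
  have hargpos : 0 < 6 * (T : ℝ) ^ 2 * n := by positivity
  have ha1 : 1 ≤ Real.log (6 * T * n / (1 / T)) := by
    rw [harg, Real.le_log_iff_exp_le hargpos]
    have : x ≤ T ^ 2 * n := by rw [hx]; nlinarith
    linarith [Real.exp_one_lt_d9]
  have ha : Real.log (6 * T * n / (1 / T)) ≤ 9 * ℓ := by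
    have h₁ : 6 * (T : ℝ) ^ 2 * n ≤ x ^ 5 := by
      have hTx : (T : ℝ) ≤ x := le_mul_of_one_le_right (by positivity) hn1
      have h₂ : (2 : ℝ) ^ 3 ≤ x ^ 3 := by gcongr
      calc 6 * (T : ℝ) ^ 2 * n = 6 * (T * x) := by rw [hx]; ring
        _ ≤ x ^ 3 * (x * x) := by gcongr; linarith
        _ = x ^ 5 := by ring
    have h₂ := Real.log_le_log hargpos h₁
    rw [Real.log_pow] at h₂
    rw [harg]
    push_cast at h₂
    linarith
  have hreg := cacheRegret_onlineCaching_le (tie := tie) hB₁.le hB hI htie hL ha1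
  rw [show (Fintype.card Q : ℝ) = n from rfl] at hreg
  refine hreg.trans ?_
  rw [Real.exp_neg, harg, Real.exp_log hargpos, ← harg]
  have hlast : T * (B₂ * (2 * n * T * (6 * T * n / (1 / T))⁻¹)) = B₂ / 3 := by
    field_simp; ring
  rw [hlast]
  have hsqrt_a : √(Real.log (6 * T * n / (1 / T))) ≤ 3 * √ℓ := by
    refine (Real.sqrt_le_sqrt ha).trans_eq ?_
    rw [Real.sqrt_mul (by norm_num)]
    congr 1
    rw [show (9 : ℝ) = 3 ^ 2 by norm_num, Real.sqrt_sq (by norm_num)]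
  have hs : √(T * ℓ) = √ℓ * √T := by rw [mul_comm, Real.sqrt_mul (by linarith)]
  have hsqrt_ℓ : 1 / 2 ≤ √ℓ := Real.le_sqrt_of_sq_le (by linarith)
  have hsqrt_T : 1 ≤ √(T : ℝ) := Real.one_le_sqrt.2 hT1
  rw [hs]
  set y := √ℓ
  set z := √(T : ℝ)
  have hB₂ : 0 < B₂ := hB₁.trans hB
  have hz : z ≤ 2 * (y * z) := by nlinarith
  have h₁ : L * (8 * (B₂ - B₁) * √(Real.log (6 * T * n / (1 / T))) * z) ≤
      24 * (L * B₂ * (y * z)) := by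
    calc _ ≤ L * (8 * B₂ * (3 * y) * z) := by gcongr; linarith
      _ = _ := by ring
  have h₂ : B₂ * ((2 * L + 1) * (2 * z)) ≤ 12 * (L * B₂ * (y * z)) := by
    calc _ ≤ B₂ * ((2 * L + L) * (2 * (2 * (y * z)))) := by gcongr
      _ = _ := by ring
  have h₃ : B₂ / 3 ≤ L * B₂ * (y * z) := by
    have hyz : 1 / 2 ≤ y * z := by nlinarith
    have : B₂ * (1 / 2) ≤ L * B₂ * (y * z) := by
      refine mul_le_mul ?_ hyz (by norm_num) (by positivity)
      nlinarith
    linarith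
  have h₄ : 0 ≤ L * B₂ * (y * z) := by positivity
  linarith

/-- When `B₁` is not too large, the frequency errors are dominated by the first term of the
bound. -/
theorem mul_sqrt_le_of_le {L T n B₁ B₂ ℓ : ℝ} (hL : 0 ≤ L) (hB₁ : 0 < B₁) (hB₂ : 0 ≤ B₂)
    (hℓ : 1 / 4 ≤ ℓ) (h : B₁ ≤ 2 * L * n * (B₂ - B₁) * ℓ) :
    L * B₂ * √(T * ℓ) ≤ 4 * (L ^ 2 * (B₂ - B₁) * B₂ * n * ℓ ^ 2 / B₁ * √T) := by
  have hsqrt : √ℓ ≤ 2 * ℓ := by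
    rw [Real.sqrt_le_left (by linarith)]
    nlinarith
  rw [mul_comm T, Real.sqrt_mul (by linarith)]
  have h' : B₁ * √ℓ ≤ 2 * L * n * (B₂ - B₁) * ℓ * (2 * ℓ) :=
    mul_le_mul h hsqrt (Real.sqrt_nonneg _) (hB₁.le.trans h)
  have h'' : √ℓ ≤ 2 * L * n * (B₂ - B₁) * ℓ * (2 * ℓ) / B₁ := by
    rw [le_div_iff₀ hB₁]; linarith
  calc L * B₂ * (√ℓ * √T) ≤
      L * B₂ * (2 * L * n * (B₂ - B₁) * ℓ * (2 * ℓ) / B₁ * √T) := by gcongr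
    _ = _ := by ring

end UpperBound

/-! ### Instances with two-point cost laws -/

section TwoPoint

theorem isProbabilityMeasure_twoPointLaw (a b : ℝ) {p : ℝ} (hp : p ∈ Set.Icc (0 : ℝ) 1) :
    IsProbabilityMeasure (twoPointLaw a b p) := by
  constructor
  rw [twoPointLaw, Measure.add_apply, Measure.smul_apply, Measure.smul_apply, measure_univ,
    measure_univ, smul_eq_mul, smul_eq_mul, mul_one, mul_one,
    ← ENNReal.ofReal_add hp.1 (sub_nonneg.2 hp.2)]
  simp

theorem integral_twoPointLaw (a b : ℝ) {p : ℝ} (hp : p ∈ Set.Icc (0 : ℝ) 1) :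
    ∫ x, x ∂twoPointLaw a b p = a + p * (b - a) := by
  have hint (c p : ℝ) : Integrable (fun x : ℝ => x) (ENNReal.ofReal p • Measure.dirac c) :=
    (integrable_dirac (by simp)).smul_measure ENNReal.ofReal_ne_top
  rw [twoPointLaw, integral_add_measure (hint _ _) (hint _ _), integral_smul_measure,
    integral_smul_measure, integral_dirac, integral_dirac, ENNReal.toReal_ofReal hp.1,
    ENNReal.toReal_ofReal (sub_nonneg.2 hp.2)]
  simp only [smul_eq_mul]
  ring

/-- The coarsening of a round that records only whether the cost is `B₂`. -/
noncomputable def encodeRound {Q : Type*} (B₂ : ℝ) (x : Q × ℝ) : Q × Bool :=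
  (x.1, decide (x.2 = B₂))

/-- The round with a given coarsening, when the costs are `B₁` or `B₂`. -/
noncomputable def decodeRound {Q : Type*} (B₁ B₂ : ℝ) (x : Q × Bool) : Q × ℝ :=
  (x.1, if x.2 then B₂ else B₁)

/-- The sequence of rounds with prescribed coarsenings of the first `t` of them. -/
noncomputable def decodeRounds {Q : Type*} [Inhabited Q] (B₁ B₂ : ℝ) (t : ℕ)
    (x : Finset.range t → Q × Bool) (i : ℕ) : Q × ℝ :=
  if h : i ∈ Finset.range t then decodeRound B₁ B₂ (x ⟨i, h⟩) else default

/-- The coarsenings of the first `t` rounds. -/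
noncomputable def encodeRounds {Q : Type*} (B₂ : ℝ) (t : ℕ) (ω : ℕ → Q × ℝ)
    (i : Finset.range t) : Q × Bool := encodeRound B₂ (ω i)

variable {Q : Type*} [MeasurableSpace Q]

theorem measurable_encodeRound (B₂ : ℝ) : Measurable (encodeRound B₂ : Q × ℝ → Q × Bool) := by
  refine measurable_fst.prodMk (measurable_to_bool ?_)
  have : (fun x : Q × ℝ => decide (x.2 = B₂)) ⁻¹' {true} = Prod.snd ⁻¹' {B₂} := by ext; simp
  rw [this]
  exact measurable_snd (measurableSet_singleton B₂)

theorem measurable_encodeRounds (B₂ : ℝ) (t : ℕ) :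
    Measurable (encodeRounds B₂ t : (ℕ → Q × ℝ) → Finset.range t → Q × Bool) :=
  measurable_pi_iff.2 fun _ => (measurable_encodeRound B₂).comp (measurable_pi_apply _)

/-- The probability of a coarsened round. -/
noncomputable def roundWeight (I : CacheInstance Q) (p : Q → ℝ) (x : Q × Bool) : ℝ :=
  (I.P x.1).toReal * if x.2 then p x.1 else 1 - p x.1

variable [Fintype Q] {I : CacheInstance Q} {B₁ B₂ : ℝ} {p : Q → ℝ}

theorem roundLaw_apply_of_twoPoint (hI : ∀ q, I.costLaw q = twoPointLaw B₁ B₂ (p q))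
    {A : Set (Q × ℝ)} (hA : MeasurableSet A) :
    I.roundLaw A = ∑ q, I.P q * (ENNReal.ofReal (p q) * A.indicator 1 (q, B₂) +
      ENNReal.ofReal (1 - p q) * A.indicator 1 (q, B₁)) := by
  rw [← lintegral_indicator_one hA, I.lintegral_roundLaw (measurable_one.indicator hA)]
  refine Finset.sum_congr rfl fun q _ => ?_
  rw [hI, twoPointLaw, lintegral_add_measure, lintegral_smul_measure, lintegral_smul_measure,
    lintegral_dirac, lintegral_dirac, smul_eq_mul, smul_eq_mul]

theorem ae_decodeRound_encodeRound (hB : B₁ < B₂)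
    (hI : ∀ q, I.costLaw q = twoPointLaw B₁ B₂ (p q)) :
    ∀ᵐ x ∂I.roundLaw, decodeRound B₁ B₂ (encodeRound B₂ x) = x := by
  have hm : MeasurableSet {x : Q × ℝ | decodeRound B₁ B₂ (encodeRound B₂ x) = x}ᶜ := by
    have : {x : Q × ℝ | decodeRound B₁ B₂ (encodeRound B₂ x) = x}ᶜ =
        Prod.snd ⁻¹' ({B₁, B₂} : Set ℝ)ᶜ := by
      ext x
      by_cases h : x.2 = B₂
      · simp [decodeRound, encodeRound, h, Prod.ext_iff]
      · simp [decodeRound, encodeRound, h, Prod.ext_iff, eq_comm (a := B₁)]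
    rw [this]
    exact measurable_snd ((Set.toFinite _).measurableSet.compl)
  rw [ae_iff]
  change I.roundLaw {x : Q × ℝ | decodeRound B₁ B₂ (encodeRound B₂ x) = x}ᶜ = 0
  rw [roundLaw_apply_of_twoPoint hI hm]
  simp [decodeRound, encodeRound, hB.ne]

theorem map_encodeRounds (I : CacheInstance Q) (B₂ : ℝ) (t : ℕ) :
    I.trajectoryLaw.map (encodeRounds B₂ t) =
      Measure.pi fun _ : Finset.range t => I.roundLaw.map (encodeRound B₂) := by
  have hprob : IsProbabilityMeasure (I.roundLaw.map (encodeRound B₂)) :=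
    Measure.isProbabilityMeasure_map (measurable_encodeRound B₂).aemeasurable
  have hm : Measurable fun (y : Finset.range t → Q × ℝ) i => encodeRound B₂ (y i) :=
    measurable_pi_iff.2 fun i => (measurable_encodeRound B₂).comp (measurable_pi_apply i)
  have hmap : I.trajectoryLaw.map (encodeRounds B₂ t) =
      (I.trajectoryLaw.map (Finset.range t).restrict).map fun y i => encodeRound B₂ (y i) :=
    (Measure.map_map hm (Finset.measurable_restrict _)).symm
  rw [hmap, CacheInstance.trajectoryLaw, Measure.infinitePi_map_restrict,
    Measure.pi_map_pi fun _ => (measurable_encodeRound B₂).aemeasurable]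

theorem ae_cacheHistory_decodeRounds [DecidableEq Q] [Inhabited Q] (hB : B₁ < B₂)
    (hI : ∀ q, I.costLaw q = twoPointLaw B₁ B₂ (p q)) (π : CachePolicy Q) (t : ℕ) :
    ∀ᵐ ω ∂I.trajectoryLaw, cacheHistory π ω t =
      cacheHistory π (decodeRounds B₁ B₂ t (encodeRounds B₂ t ω)) t := by
  have h (i : ℕ) : ∀ᵐ ω ∂I.trajectoryLaw, decodeRound B₁ B₂ (encodeRound B₂ (ω i)) = ω i :=
    (measurePreserving_eval_infinitePi (fun _ : ℕ => I.roundLaw) i).quasiMeasurePreserving.ae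
      (ae_decodeRound_encodeRound hB hI)
  filter_upwards [ae_all_iff.2 h] with ω hω
  refine cacheHistory_congr π fun i hi => ?_
  rw [decodeRounds, dif_pos (Finset.mem_range.2 hi), encodeRounds, hω i]

variable [DiscreteMeasurableSpace Q]

theorem map_encodeRound_real_singleton [DecidableEq Q] (hB : B₁ < B₂)
    (hp : ∀ q, p q ∈ Set.Icc (0 : ℝ) 1)
    (hI : ∀ q, I.costLaw q = twoPointLaw B₁ B₂ (p q)) (x : Q × Bool) :
    (I.roundLaw.map (encodeRound B₂)).real {x} = roundWeight I p x := by
  obtain ⟨q, b⟩ := x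
  have hm := measurable_encodeRound (Q := Q) B₂ (measurableSet_singleton (q, b))
  rw [measureReal_def, Measure.map_apply (measurable_encodeRound B₂) (measurableSet_singleton _),
    roundLaw_apply_of_twoPoint hI hm, Finset.sum_eq_single q]
  · rw [ENNReal.toReal_mul, roundWeight]
    congr 1
    cases b
    · simp [encodeRound, hB.ne, ENNReal.toReal_ofReal (sub_nonneg.2 (hp q).2)]
    · simp [encodeRound, hB.ne, ENNReal.toReal_ofReal (hp q).1]
  · intro q' _ hq'
    simp [encodeRound, hq']
  · simp

variable [DecidableEq Q] [Inhabited Q]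

/-- No measurability of the policy in the observed costs is needed, since almost surely only
finitely many histories occur. -/
theorem nullMeasurableSet_mem_cache (hB : B₁ < B₂)
    (hI : ∀ q, I.costLaw q = twoPointLaw B₁ B₂ (p q)) (π : CachePolicy Q) (t : ℕ) (q : Q) :
    NullMeasurableSet {ω | q ∈ π (cacheHistory π ω t)} I.trajectoryLaw := by
  have hm : MeasurableSet (encodeRounds B₂ t ⁻¹'
      {x | q ∈ π (cacheHistory π (decodeRounds B₁ B₂ t x) t)}) :=
    measurable_encodeRounds B₂ t (Set.toFinite _).measurableSet
  refine hm.nullMeasurableSet.congr ?_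
  filter_upwards [ae_cacheHistory_decodeRounds hB hI π t] with ω hω
  refine propext ?_
  change q ∈ π _ ↔ q ∈ π _
  rw [← hω]

/-- The expectation of a function of the cache is a finite sum over the coarsened rounds. -/
theorem integral_cache_eq_sum (hB : B₁ < B₂) (hp : ∀ q, p q ∈ Set.Icc (0 : ℝ) 1)
    (hI : ∀ q, I.costLaw q = twoPointLaw B₁ B₂ (p q)) (π : CachePolicy Q) (t : ℕ)
    (φ : Finset Q → ℝ) :
    ∫ ω, φ (π (cacheHistory π ω t)) ∂I.trajectoryLaw =
      ∑ x : Finset.range t → Q × Bool, (∏ i, roundWeight I p (x i)) *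
        φ (π (cacheHistory π (decodeRounds B₁ B₂ t x) t)) := by
  have hprob : IsProbabilityMeasure (I.roundLaw.map (encodeRound B₂)) :=
    Measure.isProbabilityMeasure_map (measurable_encodeRound B₂).aemeasurable
  have hae : (fun ω => φ (π (cacheHistory π ω t))) =ᵐ[I.trajectoryLaw] fun ω =>
      φ (π (cacheHistory π (decodeRounds B₁ B₂ t (encodeRounds B₂ t ω)) t)) := by
    filter_upwards [ae_cacheHistory_decodeRounds hB hI π t] with ω hω
    rw [← hω]
  rw [integral_congr_ae hae, ← integral_map
    (f := fun x => φ (π (cacheHistory π (decodeRounds B₁ B₂ t x) t)))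
    (measurable_encodeRounds B₂ t).aemeasurable
    (measurable_of_finite _).aestronglyMeasurable, map_encodeRounds, integral_fintype .of_finite]
  refine Finset.sum_congr rfl fun x _ => ?_
  rw [smul_eq_mul, measureReal_def, Measure.pi_singleton, ENNReal.toReal_prod]
  congr 1
  exact Finset.prod_congr rfl fun i _ => map_encodeRound_real_singleton hB hp hI (x i)

theorem cacheRegret_eq_sum (hB : B₁ < B₂) (hp : ∀ q, p q ∈ Set.Icc (0 : ℝ) 1)
    (hI : ∀ q, I.costLaw q = twoPointLaw B₁ B₂ (p q)) (π : CachePolicy Q) (Lstar : Finset Q)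
    (T : ℕ) :
    cacheRegret I π Lstar T = ∑ t ∈ Finset.range T, ∑ x : Finset.range t → Q × Bool,
      (∏ i, roundWeight I p (x i)) *
        (I.expectedCost (π (cacheHistory π (decodeRounds B₁ B₂ t x) t)) -
          I.expectedCost Lstar) := by
  rw [cacheRegret_eq I π Lstar T fun t q => nullMeasurableSet_mem_cache hB hI π t q]
  exact Finset.sum_congr rfl fun t _ => integral_cache_eq_sum hB hp hI π t
    fun S => I.expectedCost S - I.expectedCost Lstar

end TwoPoint

/-! ### Randomized policies -/

section Randomized

variable {Q R : Type*} [DecidableEq Q] [MeasurableSpace R]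

/-- For a fixed sequence of rounds only finitely many histories are possible. -/
theorem exists_finite_histories {π : R → CachePolicy Q}
    (hπ : ∀ H q, MeasurableSet {r | q ∈ π r H}) (y : ℕ → Q × ℝ) (t : ℕ) :
    (∃ F : Finset (CacheHistory Q), ∀ r, cacheHistory (π r) y t ∈ F) ∧
      ∀ H, MeasurableSet {r | cacheHistory (π r) y t = H} := by
  classical
  induction t with
  | zero => exact ⟨⟨{[]}, fun r => by simp [cacheHistory]⟩, fun H => by simp [cacheHistory]⟩
  | succ t ih =>
    obtain ⟨⟨F, hF⟩, hm⟩ := ih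
    refine ⟨⟨F.image (fun H => ((y t).1, none) :: H) ∪
      F.image (fun H => ((y t).1, some (y t).2) :: H), fun r => ?_⟩, fun H => ?_⟩
    · simp only [cacheHistory, Finset.mem_union, Finset.mem_image]
      split_ifs
      exacts [Or.inl ⟨_, hF r, rfl⟩, Or.inr ⟨_, hF r, rfl⟩]
    · cases H with
      | nil => simp [cacheHistory]
      | cons e H =>
        have : {r | cacheHistory (π r) y (t + 1) = e :: H} =
            {r | cacheHistory (π r) y t = H} ∩
              {r | ((y t).1, if (y t).1 ∈ π r H then none else some (y t).2) = e} := by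
          ext r
          simp only [cacheHistory, List.cons.injEq, Set.mem_inter_iff, Set.mem_ofPred_eq]
          constructor
          · rintro ⟨h₁, h₂⟩; exact ⟨h₂, by rw [← h₂]; exact h₁⟩
          · rintro ⟨h₁, h₂⟩; exact ⟨by rw [h₁]; exact h₂, h₁⟩
        rw [this]
        refine (hm H).inter ?_
        have hite : {r | ((y t).1, if (y t).1 ∈ π r H then none else some (y t).2) = e} =
            ({r | (y t).1 ∈ π r H} ∩ {_r | ((y t).1, none) = e}) ∪
              ({r | (y t).1 ∈ π r H}ᶜ ∩ {_r | ((y t).1, some (y t).2) = e}) := by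
          ext r
          by_cases h : (y t).1 ∈ π r H <;> simp [h]
        rw [hite]
        exact ((hπ H _).inter (.const _)).union ((hπ H _).compl.inter (.const _))

theorem measurableSet_mem_cache_of_randomized {π : R → CachePolicy Q}
    (hπ : ∀ H q, MeasurableSet {r | q ∈ π r H}) (y : ℕ → Q × ℝ) (t : ℕ) (q : Q) :
    MeasurableSet {r | q ∈ π r (cacheHistory (π r) y t)} := by
  obtain ⟨⟨F, hF⟩, hm⟩ := exists_finite_histories hπ y t
  have : {r | q ∈ π r (cacheHistory (π r) y t)} =
      ⋃ H ∈ F, {r | cacheHistory (π r) y t = H} ∩ {r | q ∈ π r H} := by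
    ext r
    simp only [Set.mem_ofPred_eq, Set.mem_iUnion, Set.mem_inter_iff]
    constructor
    · intro h; exact ⟨_, hF r, rfl, h⟩
    · rintro ⟨H, -, rfl, h⟩; exact h
  rw [this]
  exact F.measurableSet_biUnion fun H _ => (hm H).inter (hπ H q)

end Randomized

/-! ### The lower bound -/

section LowerBound

/-- The overlap of two probability distributions is at least half the square of their Bhattacharyya
coefficient. -/
theorem sq_sum_sqrt_mul_le {α : Type*} [Fintype α] {f g : α → ℝ} (hf : ∀ x, 0 ≤ f x)
    (hg : ∀ x, 0 ≤ g x) (hf1 : ∑ x, f x = 1) (hg1 : ∑ x, g x = 1) :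
    (∑ x, √(f x * g x)) ^ 2 ≤ 2 * ∑ x, min (f x) (g x) := by
  have hmin (x : α) : 0 ≤ min (f x) (g x) := le_min (hf x) (hg x)
  have hmax (x : α) : 0 ≤ max (f x) (g x) := (hf x).trans (le_max_left _ _)
  have hsum : ∑ x, √(f x * g x) = ∑ x, √(min (f x) (g x)) * √(max (f x) (g x)) := by
    refine Finset.sum_congr rfl fun x _ => ?_
    rw [← Real.sqrt_mul (hmin x), min_mul_max]
  have hle2 : ∑ x, max (f x) (g x) ≤ 2 := by
    calc ∑ x, max (f x) (g x) ≤ ∑ x, (f x + g x) :=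
          Finset.sum_le_sum fun x _ => max_le_add_of_nonneg (hf x) (hg x)
      _ = 2 := by rw [Finset.sum_add_distrib, hf1, hg1]; norm_num
  have hcs := Finset.sum_mul_sq_le_sq_mul_sq Finset.univ (fun x => √(min (f x) (g x)))
    fun x => √(max (f x) (g x))
  simp only [Real.sq_sqrt (hmin _), Real.sq_sqrt (hmax _)] at hcs
  rw [hsum]
  refine hcs.trans ?_
  rw [mul_comm]
  exact mul_le_mul_of_nonneg_right hle2 (Finset.sum_nonneg fun x _ => hmin x)

theorem prod_nonneg_and_sum_prod_eq_one {ι β : Type*} [Fintype ι] [DecidableEq ι] [Fintype β]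
    {f : β → ℝ} (hf : ∀ b, 0 ≤ f b) (hf1 : ∑ b, f b = 1) :
    (∀ x : ι → β, 0 ≤ ∏ i, f (x i)) ∧ ∑ x : ι → β, ∏ i, f (x i) = 1 := by
  refine ⟨fun x => Finset.prod_nonneg fun i _ => hf _, ?_⟩
  have h := Finset.prod_univ_sum (fun _ : ι => (Finset.univ : Finset β)) fun _ b => f b
  rw [Fintype.piFinset_univ] at h
  rw [← h]
  simp [hf1]

/-- The Bhattacharyya coefficient is multiplicative over independent samples. -/
theorem sum_min_prod_ge {ι β : Type*} [Fintype ι] [DecidableEq ι] [Fintype β] {f g : β → ℝ}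
    (hf : ∀ b, 0 ≤ f b) (hg : ∀ b, 0 ≤ g b) (hf1 : ∑ b, f b = 1) (hg1 : ∑ b, g b = 1) :
    ((∑ b, √(f b * g b)) ^ 2) ^ Fintype.card ι / 2 ≤
      ∑ x : ι → β, min (∏ i, f (x i)) (∏ i, g (x i)) := by
  obtain ⟨hF, hF1⟩ := prod_nonneg_and_sum_prod_eq_one (ι := ι) hf hf1
  obtain ⟨hG, hG1⟩ := prod_nonneg_and_sum_prod_eq_one (ι := ι) hg hg1
  have hprod : ∑ x : ι → β, √((∏ i, f (x i)) * ∏ i, g (x i)) =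
      (∑ b, √(f b * g b)) ^ Fintype.card ι := by
    have h := Finset.prod_univ_sum (fun _ : ι => (Finset.univ : Finset β))
      fun _ b => √(f b * g b)
    rw [Fintype.piFinset_univ, Finset.prod_const, Finset.card_univ] at h
    rw [h]
    refine Finset.sum_congr rfl fun x _ => ?_
    rw [← Finset.prod_mul_distrib, Real.sqrt_prod _ fun i _ => mul_nonneg (hf _) (hg _)]
  have h := sq_sum_sqrt_mul_le hF hG hF1 hG1
  rw [hprod, ← pow_mul, mul_comm, pow_mul] at h
  linarith

/-- The success probability of the cost of the query `q`, when `θ` is the expensive query. -/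
noncomputable def hardProb (ε : ℝ) (θ q : Fin 2) : ℝ := if q = θ then 1 / 2 + ε else 1 / 2 - ε

theorem hardProb_mem_Icc {ε : ℝ} (hε : ε ∈ Set.Icc (0 : ℝ) (1 / 2)) (θ q : Fin 2) :
    hardProb ε θ q ∈ Set.Icc (0 : ℝ) 1 := by
  obtain ⟨h₀, h₁⟩ := hε
  unfold hardProb
  split_ifs <;> constructor <;> linarith

/-- Two equally frequent queries, of which the query `θ` is slightly more expensive. -/
noncomputable def hardInstance (B₁ B₂ : ℝ) {ε : ℝ} (hε : ε ∈ Set.Icc (0 : ℝ) (1 / 2))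
    (θ : Fin 2) : CacheInstance (Fin 2) where
  P := PMF.uniformOfFintype (Fin 2)
  costLaw q := twoPointLaw B₁ B₂ (hardProb ε θ q)
  isProbability_costLaw q := isProbabilityMeasure_twoPointLaw B₁ B₂ (hardProb_mem_Icc hε θ q)

variable {B₁ B₂ ε : ℝ} (hε : ε ∈ Set.Icc (0 : ℝ) (1 / 2))

theorem hardInstance_P (θ q : Fin 2) : ((hardInstance B₁ B₂ hε θ).P q).toReal = 1 / 2 := by
  simp [hardInstance]

theorem meanCost_hardInstance (θ q : Fin 2) :
    (hardInstance B₁ B₂ hε θ).meanCost q = B₁ + hardProb ε θ q * (B₂ - B₁) :=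
  integral_twoPointLaw B₁ B₂ (hardProb_mem_Icc hε θ q)

/-- Not caching the expensive query costs `ε * (B₂ - B₁)` more than caching it. -/
theorem expectedCost_hardInstance_ge (hB₁ : 0 ≤ B₁) (hB : B₁ < B₂) (θ : Fin 2)
    {S : Finset (Fin 2)} (hS : S.card ≤ 1) :
    (hardInstance B₁ B₂ hε θ).expectedCost {θ} + (if θ ∈ S then 0 else ε * (B₂ - B₁)) ≤
      (hardInstance B₁ B₂ hε θ).expectedCost S := by
  have hΔ : 0 < B₂ - B₁ := sub_pos.2 hB
  split_ifs with hθ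
  · rw [Finset.eq_singleton_iff_unique_mem.2 ⟨hθ, fun q hq => Finset.card_le_one.1 hS q hq θ hθ⟩,
      add_zero]
  · rw [CacheInstance.expectedCost_eq, CacheInstance.expectedCost_eq, Finset.sum_singleton,
      hardInstance_P, meanCost_hardInstance]
    have hle : ∑ q ∈ S, ((hardInstance B₁ B₂ hε θ).P q).toReal *
        (hardInstance B₁ B₂ hε θ).meanCost q ≤ 1 / 2 * (B₁ + (1 / 2 - ε) * (B₂ - B₁)) := by
      have hval (q : Fin 2) (hq : q ∈ S) : ((hardInstance B₁ B₂ hε θ).P q).toReal *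
          (hardInstance B₁ B₂ hε θ).meanCost q = 1 / 2 * (B₁ + (1 / 2 - ε) * (B₂ - B₁)) := by
        rw [hardInstance_P, meanCost_hardInstance, hardProb, if_neg fun h : q = θ => hθ (h ▸ hq)]
      have hnonneg : 0 ≤ 1 / 2 * (B₁ + (1 / 2 - ε) * (B₂ - B₁)) := by
        have := mul_nonneg (sub_nonneg.2 hε.2) hΔ.le
        linarith
      rw [Finset.sum_congr rfl hval, Finset.sum_const, nsmul_eq_mul]
      exact mul_le_of_le_one_left hnonneg (by exact_mod_cast hS)
    rw [hardProb, if_pos rfl]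
    linarith

theorem roundWeight_hardInstance (θ : Fin 2) (x : Fin 2 × Bool) :
    roundWeight (hardInstance B₁ B₂ hε θ) (hardProb ε θ) x =
      1 / 2 * if x.2 then hardProb ε θ x.1 else 1 - hardProb ε θ x.1 := by
  rw [roundWeight, hardInstance_P]

/-- When `ε` is of order `1 / √T`, the two hard instances cannot be told apart within `T` rounds,
even if all costs are shown. -/
theorem sum_min_roundWeight_ge {T t : ℕ} (ht : t ≤ T) (hεT : 16 * ε ^ 2 * T ≤ 1) :
    3 / 8 ≤ ∑ x : Finset.range t → Fin 2 × Bool,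
      min (∏ i, roundWeight (hardInstance B₁ B₂ hε 0) (hardProb ε 0) (x i))
        (∏ i, roundWeight (hardInstance B₁ B₂ hε 1) (hardProb ε 1) (x i)) := by
  have hnonneg (θ : Fin 2) (x : Fin 2 × Bool) :
      0 ≤ roundWeight (hardInstance B₁ B₂ hε θ) (hardProb ε θ) x := by
    obtain ⟨h₀, h₁⟩ := hardProb_mem_Icc hε θ x.1
    rw [roundWeight_hardInstance]
    split_ifs <;> linarith
  have hone (θ : Fin 2) :
      ∑ x, roundWeight (hardInstance B₁ B₂ hε θ) (hardProb ε θ) x = 1 := by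
    simp only [roundWeight_hardInstance, Fintype.sum_prod_type, Fin.sum_univ_two, Fintype.sum_bool]
    simp only [if_true, Bool.false_eq_true, if_false]
    ring
  have hsq : 0 ≤ 1 / 4 - ε ^ 2 := by nlinarith [hε.1, hε.2]
  have hcoeff : ∑ x, √(roundWeight (hardInstance B₁ B₂ hε 0) (hardProb ε 0) x *
      roundWeight (hardInstance B₁ B₂ hε 1) (hardProb ε 1) x) = 2 * √(1 / 4 - ε ^ 2) := by
    have hterm (x : Fin 2 × Bool) :
        √(roundWeight (hardInstance B₁ B₂ hε 0) (hardProb ε 0) x *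
          roundWeight (hardInstance B₁ B₂ hε 1) (hardProb ε 1) x) =
        1 / 2 * √(1 / 4 - ε ^ 2) := by
      have : roundWeight (hardInstance B₁ B₂ hε 0) (hardProb ε 0) x *
          roundWeight (hardInstance B₁ B₂ hε 1) (hardProb ε 1) x =
          (1 / 2) ^ 2 * (1 / 4 - ε ^ 2) := by
        obtain ⟨q, b⟩ := x
        rw [roundWeight_hardInstance, roundWeight_hardInstance]
        fin_cases q <;> cases b <;> simp [hardProb] <;> ring
      rw [this, Real.sqrt_mul (by norm_num), Real.sqrt_sq (by norm_num)]
    simp only [hterm, Finset.sum_const, Finset.card_univ, Fintype.card_prod, Fintype.card_fin,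
      Fintype.card_bool, nsmul_eq_mul]
    push_cast
    ring
  refine le_trans ?_ (sum_min_prod_ge (ι := Finset.range t) (hnonneg 0) (hnonneg 1) (hone 0)
    (hone 1))
  rw [hcoeff, mul_pow, Real.sq_sqrt hsq, Fintype.card_coe, Finset.card_range]
  have hbern := one_add_mul_le_pow (a := -(4 * ε ^ 2)) (by nlinarith) t
  have hbase : (2 : ℝ) ^ 2 * (1 / 4 - ε ^ 2) = 1 + -(4 * ε ^ 2) := by ring
  rw [hbase]
  have htT : (t : ℝ) ≤ T := by exact_mod_cast ht
  nlinarith [sq_nonneg ε]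

theorem cacheRegret_hardInstance_add_ge (hB₁ : 0 ≤ B₁) (hB : B₁ < B₂) {T : ℕ}
    (hεT : 16 * ε ^ 2 * T ≤ 1) {π : CachePolicy (Fin 2)} (hπ : ∀ H, (π H).card ≤ 1)
    {Lstar : Fin 2 → Finset (Fin 2)}
    (hL : ∀ θ, (hardInstance B₁ B₂ hε θ).IsOptimalCache 1 (Lstar θ)) :
    T * (3 / 8 * (ε * (B₂ - B₁))) ≤
      cacheRegret (hardInstance B₁ B₂ hε 0) π (Lstar 0) T +
        cacheRegret (hardInstance B₁ B₂ hε 1) π (Lstar 1) T := by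
  have hgap : 0 ≤ ε * (B₂ - B₁) := mul_nonneg hε.1 (sub_nonneg.2 hB.le)
  have hexcess (θ : Fin 2) (H : CacheHistory (Fin 2)) :
      (if θ ∈ π H then 0 else ε * (B₂ - B₁)) ≤
        (hardInstance B₁ B₂ hε θ).expectedCost (π H) -
          (hardInstance B₁ B₂ hε θ).expectedCost (Lstar θ) := by
    have h₁ := expectedCost_hardInstance_ge hε hB₁ hB θ (hπ H)
    have h₂ := (hL θ).2 {θ} (by simp)
    linarith
  rw [cacheRegret_eq_sum hB (hardProb_mem_Icc hε 0) (fun _ => rfl),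
    cacheRegret_eq_sum hB (hardProb_mem_Icc hε 1) (fun _ => rfl), ← Finset.sum_add_distrib]
  rw [show (T : ℝ) * (3 / 8 * (ε * (B₂ - B₁))) =
    ∑ _t ∈ Finset.range T, 3 / 8 * (ε * (B₂ - B₁)) by simp]
  refine Finset.sum_le_sum fun t ht => ?_
  have hmin := sum_min_roundWeight_ge (B₁ := B₁) (B₂ := B₂) hε (Finset.mem_range.1 ht).le hεT
  refine (mul_le_mul_of_nonneg_right hmin hgap).trans ?_
  rw [Finset.sum_mul, ← Finset.sum_add_distrib]
  refine Finset.sum_le_sum fun x _ => ?_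
  set H := cacheHistory π (decodeRounds B₁ B₂ t x) t
  have hW (θ : Fin 2) :
      0 ≤ ∏ i, roundWeight (hardInstance B₁ B₂ hε θ) (hardProb ε θ) (x i) := by
    refine Finset.prod_nonneg fun i _ => ?_
    obtain ⟨h₀, h₁⟩ := hardProb_mem_Icc hε θ (x i).1
    rw [roundWeight_hardInstance]
    split_ifs <;> linarith
  have h₀ := mul_le_mul_of_nonneg_left (hexcess 0 H) (hW 0)
  have h₁ := mul_le_mul_of_nonneg_left (hexcess 1 H) (hW 1)
  refine le_trans ?_ (add_le_add h₀ h₁)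
  -- A cache of size one misses the expensive query of at least one of the two instances.
  by_cases hmem : (0 : Fin 2) ∈ π H
  · have hmem' : (1 : Fin 2) ∉ π H := fun h =>
      absurd (Finset.card_le_one.1 (hπ H) 0 hmem 1 h) (by decide)
    rw [if_pos hmem, if_neg hmem', mul_zero, zero_add]
    exact mul_le_mul_of_nonneg_right (min_le_right _ _) hgap
  · rw [if_neg hmem]
    refine (mul_le_mul_of_nonneg_right (min_le_left _ _) hgap).trans
      (le_add_of_nonneg_right (mul_nonneg (hW 1) ?_))
    split_ifs
    exacts [le_rfl, hgap]

theorem integrable_cacheRegret_hardInstance (hB : B₁ < B₂) (θ : Fin 2) {R : Type*}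
    [MeasurableSpace R] (ρ : Measure R) [IsProbabilityMeasure ρ] {π : R → CachePolicy (Fin 2)}
    (hπ : ∀ H q, MeasurableSet {r | q ∈ π r H}) (Lstar : Finset (Fin 2)) (T : ℕ) :
    Integrable (fun r => cacheRegret (hardInstance B₁ B₂ hε θ) (π r) Lstar T) ρ := by
  have hsum (r : R) := cacheRegret_eq_sum (I := hardInstance B₁ B₂ hε θ) hB
    (hardProb_mem_Icc hε θ) (fun _ => rfl) (π r) Lstar T
  simp only [hsum]
  refine integrable_finsetSum _ fun t _ => integrable_finsetSum _ fun x _ =>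
    Integrable.const_mul ?_ _
  exact integrable_comp_finset
    (S := fun r => π r (cacheHistory (π r) (decodeRounds B₁ B₂ t x) t))
    (f := fun A _ => (hardInstance B₁ B₂ hε θ).expectedCost A -
      (hardInstance B₁ B₂ hε θ).expectedCost Lstar)
    (fun q => (measurableSet_mem_cache_of_randomized hπ _ t q).nullMeasurableSet)
    fun A => integrable_const _

/-- Averaged over the two hard instances, every randomized policy has regret of order `√T`. -/
theorem exists_hardInstance_cacheRegret_ge (hB₁ : 0 ≤ B₁) (hB : B₁ < B₂) {T : ℕ}
    (hεT : 16 * ε ^ 2 * T ≤ 1) {R : Type*} [MeasurableSpace R] (ρ : Measure R)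
    [IsProbabilityMeasure ρ] {π : R → CachePolicy (Fin 2)}
    (hπ : ∀ H q, MeasurableSet {r | q ∈ π r H}) (hcard : ∀ r H, (π r H).card ≤ 1) :
    ∃ θ, ∀ Lstar, (hardInstance B₁ B₂ hε θ).IsOptimalCache 1 Lstar →
      3 / 16 * (T * (ε * (B₂ - B₁))) ≤
        ∫ r, cacheRegret (hardInstance B₁ B₂ hε θ) (π r) Lstar T ∂ρ := by
  by_contra! hcontra
  choose Lstar hL hlt using hcontra
  have hint (θ : Fin 2) := integrable_cacheRegret_hardInstance hε hB θ ρ hπ (Lstar θ) T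
  have hmono := integral_mono (integrable_const (T * (3 / 8 * (ε * (B₂ - B₁)))))
    ((hint 0).add (hint 1))
    fun r => cacheRegret_hardInstance_add_ge hε hB₁ hB hεT (hcard r) hL
  simp only [Pi.add_apply] at hmono
  rw [integral_add (hint 0) (hint 1), integral_const, probReal_univ, one_smul] at hmono
  linarith [hlt 0, hlt 1]

end LowerBound

/-! ### Regret bounds for online caching -/

theorem theorem2 :
    (∃ C : ℝ, 0 < C ∧
      ∀ (Q : Type*) [Fintype Q] [DecidableEq Q] [MeasurableSpace Q] [DiscreteMeasurableSpace Q]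
        (L T : ℕ) (B₁ B₂ : ℝ) (I : CacheInstance Q) (tie : List Q → Finset Q → Q)
        (Lstar : Finset Q),
        0 < B₁ → B₁ < B₂ →
        2 ≤ T * Fintype.card Q →
        (∀ q, ∀ᵐ x ∂(I.costLaw q), x ∈ Set.Icc B₁ B₂) →
        (∀ qs M, M.Nonempty → tie qs M ∈ M) →
        I.IsOptimalCache L Lstar →
        cacheRegret I (onlineCaching L B₁ B₂ T (1 / T) tie) Lstar T ≤
            C * ((L : ℝ) ^ 2 * (B₂ - B₁) * B₂ * Fintype.card Q *
                  Real.log (T * Fintype.card Q) ^ 2 / B₁ * √T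
                + L * B₂ * √(T * Real.log (T * Fintype.card Q))) ∧
          (B₁ ≤ 2 * L * Fintype.card Q * (B₂ - B₁) * Real.log (T * Fintype.card Q) →
            cacheRegret I (onlineCaching L B₁ B₂ T (1 / T) tie) Lstar T ≤
              C * (L : ℝ) ^ 2 * (B₂ - B₁) * B₂ * Fintype.card Q *
                  Real.log (T * Fintype.card Q) ^ 2 / B₁ * √T)) ∧
    (∃ C' : ℝ, 0 < C' ∧
      ∀ (B₁ B₂ : ℝ) (T : ℕ), 0 ≤ B₁ → B₁ < B₂ → 1 ≤ T →
      ∀ (R : Type*) [MeasurableSpace R] (ρ : Measure R) [IsProbabilityMeasure ρ]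
        (π : R → CachePolicy (Fin 2)),
        (∀ H q, MeasurableSet {r | q ∈ π r H}) →
        (∀ r H, (π r H).card ≤ 1) →
        ∃ I : CacheInstance (Fin 2),
          (∀ q, ∃ p ∈ Set.Icc (0 : ℝ) 1, I.costLaw q = twoPointLaw B₁ B₂ p) ∧
          ∀ Lstar, I.IsOptimalCache 1 Lstar →
            C' * (B₂ - B₁) * √T ≤ ∫ r, cacheRegret I (π r) Lstar T ∂ρ) := by
  refine ⟨⟨160, by norm_num, ?_⟩, ⟨3 / 64, by norm_num, ?_⟩⟩
  · intro Q _ _ _ _ L T B₁ B₂ I tie Lstar hB₁ hB hT hI htie hL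
    have hreg := cacheRegret_onlineCaching_le_sqrt hB₁ hB hT hI htie hL.1
    have hΔ : 0 < B₂ - B₁ := sub_pos.2 hB
    have hB₂ : 0 < B₂ := hB₁.trans hB
    constructor
    · have h₁ : 0 ≤ (L : ℝ) ^ 2 * (B₂ - B₁) * B₂ * Fintype.card Q *
          Real.log (T * Fintype.card Q) ^ 2 / B₁ * √T := by positivity
      have h₂ : 0 ≤ L * B₂ * √(T * Real.log (T * Fintype.card Q)) := by positivity
      linarith
    · intro h
      have hℓ : 1 / 4 ≤ Real.log (T * Fintype.card Q) := by
        have hx : (2 : ℝ) ≤ T * Fintype.card Q := by exact_mod_cast hT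
        linarith [Real.log_le_log (by norm_num) hx, Real.log_two_gt_d9]
      have hdom := mul_sqrt_le_of_le (T := T) (Nat.cast_nonneg L) hB₁ hB₂.le hℓ h
      refine hreg.trans ((mul_le_mul_of_nonneg_left hdom (by norm_num)).trans_eq ?_)
      ring
  · intro B₁ B₂ T hB₁ hB hT R _ ρ _ π hπ hcard
    have hT1 : (1 : ℝ) ≤ T := by exact_mod_cast hT
    have hs1 : 1 ≤ √(T : ℝ) := Real.one_le_sqrt.2 hT1
    have hs2 : √(T : ℝ) ^ 2 = T := Real.sq_sqrt (by linarith)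
    have hs0 : 0 < √(T : ℝ) := by linarith
    have hε : 1 / (4 * √(T : ℝ)) ∈ Set.Icc (0 : ℝ) (1 / 2) := by
      refine ⟨by positivity, ?_⟩
      exact one_div_le_one_div_of_le (by norm_num) (by linarith)
    have hεT : 16 * (1 / (4 * √(T : ℝ))) ^ 2 * T ≤ 1 := by
      rw [div_pow, mul_pow, hs2]
      field_simp
      norm_num
    obtain ⟨θ, hθ⟩ := exists_hardInstance_cacheRegret_ge hε hB₁ hB hεT ρ hπ hcard
    refine ⟨hardInstance B₁ B₂ hε θ, fun q => ⟨_, hardProb_mem_Icc hε θ q, rfl⟩,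
      fun Lstar hL => (hθ Lstar hL).trans' (le_of_eq ?_)⟩
    have hTs : (T : ℝ) * (1 / (4 * √(T : ℝ)) * (B₂ - B₁)) = √T / 4 * (B₂ - B₁) := by
      rw [← hs2, Real.sqrt_sq hs0.le]
      field_simp
    rw [hTs]
    ring
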